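/- Let $m,n\in\mathbb N$, $T>0$ and $p\in[1,\infty)$. Write $\|\cdot\|_2$ for the Euclidean norm of vectors and the spectral norm of matrices, and equip $\mathbb R^{m\times n}\times\mathbb R\times\mathbb R$ with the norm $\|U\|_2+|\eta|+|\zeta|$. Let $\partial\mathcal R(x)=\{g:\mathcal R(z)\ge\mathcal R(x)+\langle g,z-x\rangle\ \forall z\in\mathbb R^n\}$ denote the convex subdifferential. Assume: (A1) $\mathcal R:\mathbb R^n\to\mathbb R$ is convex; (A2) $0\in\partial\mathcal R(0)$; (A3) there is $M>0$ such that for every $x\in\mathbb R^n$ either $\|z\|_2\le M\|x\|_2$ for all $z\in\partial\mathcal R(x)$, or $\|z\|_2\le M$ for all $z\in\partial\mathcal R(x)$; (A4) $\mathcal L:\mathbb R^n\times\mathbb R^n\to\mathbb R$ is continuous and nonnegative; (A5) $\psi:\mathbb R\to[0,\infty)$ is locally Lipschitz. Let $b\in\mathbb R^m$, $x^0,y\in\mathbb R^n$, $\beta_1,\beta_2,\beta_3\ge0$, and let $\mathscr D\subset L^\infty([0,T];\mathbb R^{m\times n}\times\mathbb R\times\mathbb R)$ be a nonempty set of triples $(A,\alpha,\lambda)$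 with $\alpha,\lambda\ge0$ a.e. Suppose that (1) $\mathscr D$ is bounded in $L^\infty([0,T];\mathbb R^{m\times n}\times\mathbb R\times\mathbb R)$; (2) $\mathscr D$ is closed in $L^p([0,T];\mathbb R^{m\times n}\times\mathbb R\times\mathbb R)$; (3) with every $u\in\mathscr D$ extended by $0$ outside $[0,T]$, $\lim_{|h|\to0}\|u(\cdot+h)-u\|_{L^p(\mathbb R;\mathbb R^{m\times n}\times\mathbb R\times\mathbb R)}=0$ uniformly for $u\in\mathscr D$. Then for every $(A,\alpha,\lambda)\in\mathscr D$ there is a unique absolutely continuous $x:[0,T]\to\mathbb R^n$ with $x(0)=x^0$ and $$0\in\dot x(t)+\alpha(t)A(t)^\top\big(A(t)x(t)-b\big)+\alpha(t)\lambda(t)\,\partial\mathcal R(x(t))\quad\text{for a.e. }t\in[0,T],$$ so that the objective $$\mathcal J(A,\alpha,\lambda)=\mathcal L(x(T);y)+\beta_1\psi\Big(\tfrac1T\int_0^T\|A(t)\|_2^p\,dt\Big)+\beta_2\psi\Big(\tfrac1T\int_0^T|\alpha(t)|^p\,dt\Big)+\beta_3\psi\Big(\tfrac1T\int_0^T|\lambda(t)|^p\,dt\Big)$$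 is well defined on $\mathscr D$, and $\mathcal J$ attains its minimum over $\mathscr D$: there is $(A^*,\alpha^*,\lambda^*)\in\mathscr D$ with $\mathcal J(A^*,\alpha^*,\lambda^*)\le\mathcal J(A,\alpha,\lambda)$ for all $(A,\alpha,\lambda)\in\mathscr D$. -/

import Mathlib

open MeasureTheory Set
open scoped ENNReal Matrix Matrix.Norms.L2Operator

namespace DeepLayer

/-- The Euclidean space `ℝⁿ`. -/
abbrev Euc (n : ℕ) : Type := EuclideanSpace ℝ (Fin n)

/-- The control space `ℝ^{m×n} × ℝ × ℝ` with the norm `‖(U, η, ζ)‖ = ‖U‖₂ + |η| + |ζ|`,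
where `‖U‖₂` is the spectral norm of `U`. -/
abbrev ControlSpace (m n : ℕ) : Type :=
  WithLp 1 (Matrix (Fin m) (Fin n) ℝ × WithLp 1 (ℝ × ℝ))

/-- The matrix component `U` of `(U, η, ζ)`. -/
def ControlSpace.A {m n : ℕ} (c : ControlSpace m n) : Matrix (Fin m) (Fin n) ℝ := c.fst

/-- The first scalar component `η` of `(U, η, ζ)` (the step size). -/
def ControlSpace.α {m n : ℕ} (c : ControlSpace m n) : ℝ := c.snd.fst

/-- The second scalar component `ζ` of `(U, η, ζ)` (the trade-off parameter). -/
def ControlSpace.lam {m n : ℕ} (c : ControlSpace m n) : ℝ := c.snd.snd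

/-- The norm of the control space is `‖U‖₂ + |η| + |ζ|`. -/
theorem norm_controlSpace {m n : ℕ} (c : ControlSpace m n) :
    ‖c‖ = ‖c.A‖ + |c.α| + |c.lam| := by
  rw [WithLp.prod_norm_eq_of_L1, WithLp.prod_norm_eq_of_L1, ← add_assoc]
  rfl

/-- Lebesgue measure on `[0, T]`. -/
noncomputable abbrev timeMeasure (T : ℝ) : Measure ℝ := volume.restrict (Icc 0 T)

/-- The convex subdifferential of `R` at `x`. -/
def subdifferential {n : ℕ} (R : Euc n → ℝ) (x : Euc n) : Set (Euc n) :=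
  {g | ∀ z, R x + inner ℝ g (z - x) ≤ R z}

/-- The data-fidelity gradient `Uᵀ (U x - b)`. -/
noncomputable def fidelityGrad {m n : ℕ} (U : Matrix (Fin m) (Fin n) ℝ) (b : Euc m)
    (x : Euc n) : Euc n :=
  WithLp.toLp 2 (Uᵀ *ᵥ (U *ᵥ x.ofLp - b.ofLp))

/-- `x` is an absolutely continuous solution on `[0, T]` of the state inclusion
`0 ∈ x'(t) + α(t) A(t)ᵀ (A(t) x(t) - b) + α(t) λ(t) ∂R(x(t))` for a.e. `t ∈ [0, T]`, `x(0) = x₀`,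
driven by the control `u = (A, α, λ)`. -/
def IsState {m n : ℕ} (T : ℝ) (R : Euc n → ℝ) (b : Euc m) (x₀ : Euc n)
    (u : ℝ → ControlSpace m n) (x : ℝ → Euc n) : Prop :=
  AbsolutelyContinuousOnInterval x 0 T ∧ x 0 = x₀ ∧
    ∀ᵐ t ∂timeMeasure T, ∃ v : Euc n, HasDerivAt x v t ∧ ∃ g ∈ subdifferential R (x t),
      v + (u t).α • fidelityGrad (u t).A b (x t) + ((u t).α * (u t).lam) • g = 0

/-- The objective `ℒ(x(T); y) + β₁ ψ(T⁻¹ ∫ ‖A‖₂^p) + β₂ ψ(T⁻¹ ∫ |α|^p) + β₃ ψ(T⁻¹ ∫ |λ|^p)`,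
evaluated at a control `u = (A, α, λ)` and its state `x`. -/
noncomputable def objective {m n : ℕ} (T p : ℝ) (ℒ : Euc n → Euc n → ℝ) (ψ : ℝ → ℝ)
    (β₁ β₂ β₃ : ℝ) (y : Euc n) (u : ℝ → ControlSpace m n) (x : ℝ → Euc n) : ℝ :=
  ℒ (x T) y
    + β₁ * ψ (T⁻¹ * ∫ t in Icc 0 T, ‖(u t).A‖ ^ p)
    + β₂ * ψ (T⁻¹ * ∫ t in Icc 0 T, |(u t).α| ^ p)
    + β₃ * ψ (T⁻¹ * ∫ t in Icc 0 T, |(u t).lam| ^ p)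

/-- A set of `L^∞` controls is closed in `L^p([0, T])`: the set of the elements of `L^p` that
agree a.e. with a member of `𝓓` is a closed subset of `L^p`. -/
def ClosedInLp {m n : ℕ} (T : ℝ) (p : ℝ≥0∞) [Fact (1 ≤ p)]
    (𝓓 : Set (Lp (ControlSpace m n) ∞ (timeMeasure T))) : Prop :=
  IsClosed {w : Lp (ControlSpace m n) p (timeMeasure T) | ∃ u ∈ 𝓓, w =ᵐ[timeMeasure T] u}

/-- `L^p`-equicontinuity under shifts: with every control extended by zero outside `[0, T]`,
`‖τ_h u - u‖_{L^p(ℝ)} → 0` as `h → 0`, uniformly for `u ∈ 𝓓`. -/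
def ShiftEquicontinuous {m n : ℕ} (T : ℝ) (p : ℝ≥0∞)
    (𝓓 : Set (Lp (ControlSpace m n) ∞ (timeMeasure T))) : Prop :=
  ∀ ε : ℝ, 0 < ε → ∃ δ : ℝ, 0 < δ ∧ ∀ h : ℝ, |h| < δ → ∀ u ∈ 𝓓,
    eLpNorm (fun t => (Icc 0 T).indicator u (t + h) - (Icc 0 T).indicator u t) p volume
      < ENNReal.ofReal ε

end DeepLayer

namespace DeepLayer

open Filter Topology

/-! ### Absolutely continuous functions -/

/-! The proof is the direct method: a minimizing sequence of controls has a subsequence converging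
a.e. to an admissible control, and the states and the objective are continuous under this mode of
convergence.

Compactness (`exists_subseq_control_tendsto_ae`) is a Kolmogorov–Riesz argument. The primitives of
bounded controls are equi-Lipschitz, so Arzelà–Ascoli makes them converge uniformly along a
subsequence. Difference quotients of the primitives are averages of shifts, hence uniformly
`L¹`-close to the controls, so the controls themselves are Cauchy in `L¹`. A further subsequence
converges a.e.; boundedness upgrades this to `L^p`, and closedness puts the limit in the control
set.

The state inclusion is governed by a monotone operator: the least-squares gradient and the
subdifferential are monotone and have nonnegative weights. Comparing two trajectories therefore
leaves only the discrepancy between the controls (`norm_sub_le_integral_controlGap`), which gives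
both uniqueness and continuity in the control.

Existence (`exists_isSol_of_forall_mem`) uses an explicit Euler scheme with an arbitrary selection
of subgradients. Monotonicity makes the approximations Cauchy. The selection need not converge, so
the limit is identified through an integrated variational inequality that involves only the
continuous function `R`; `isSol_of_variational` recovers the inclusion from it. -/

theorem absolutelyContinuousOnInterval_norm {E : Type*} [NormedAddCommGroup E] {x : ℝ → E}
    {a b : ℝ} (hx : AbsolutelyContinuousOnInterval x a b) :
    AbsolutelyContinuousOnInterval (fun t => ‖x t‖) a b := by
  refine squeeze_zero (fun t => Finset.sum_nonneg fun i _ => dist_nonneg) (fun t => ?_) hx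
  refine Finset.sum_le_sum fun i _ => ?_
  rw [Real.dist_eq, dist_eq_norm]
  exact abs_norm_sub_norm_le _ _

theorem absolutelyContinuousOnInterval_const {X : Type*} [PseudoMetricSpace X] (z : X) (a b : ℝ) :
    AbsolutelyContinuousOnInterval (fun _ => z) a b :=
  LipschitzOnWith.absolutelyContinuousOnInterval (K := 0)
    (LipschitzWith.const z).lipschitzOnWith

/-- The squared norm of an absolutely continuous curve is absolutely continuous, so the fundamental
theorem of calculus applies with derivative `2⟨x, x'⟩`. All energy estimates below are instances of
this. -/
theorem norm_sq_sub_le_integral {E : Type*} [NormedAddCommGroup E] [InnerProductSpace ℝ E]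
    {x : ℝ → E} {ρ : ℝ → ℝ} {T s t : ℝ} (hx : AbsolutelyContinuousOnInterval x 0 T)
    (hρ : IntegrableOn ρ (Icc 0 T))
    (hd : ∀ᵐ τ ∂timeMeasure T, ∃ v, HasDerivAt x v τ ∧ 2 * inner ℝ (x τ) v ≤ ρ τ)
    (hs : 0 ≤ s) (hst : s ≤ t) (ht : t ≤ T) :
    ‖x t‖ ^ 2 - ‖x s‖ ^ 2 ≤ ∫ τ in s..t, ρ τ := by
  have hsub : Icc s t ⊆ Icc 0 T := Icc_subset_Icc hs ht
  have h0T : (0 : ℝ) ≤ T := hs.trans (hst.trans ht)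
  have hx' : AbsolutelyContinuousOnInterval x s t := hx.mono (by
    rwa [uIcc_of_le hst, uIcc_of_le h0T])
  have hn := absolutelyContinuousOnInterval_norm hx'
  have hsq := hn.fun_mul hn
  have hint := hsq.integral_deriv_eq_sub
  have : ‖x t‖ ^ 2 - ‖x s‖ ^ 2 = ∫ τ in s..t, deriv (fun τ => ‖x τ‖ * ‖x τ‖) τ := by
    rw [hint]; ring
  rw [this]
  refine intervalIntegral.integral_mono_ae_restrict hst hsq.intervalIntegrable_deriv
    ((intervalIntegrable_iff_integrableOn_Icc_of_le hst).2 (hρ.mono_set hsub)) ?_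
  filter_upwards [ae_restrict_of_ae_restrict_of_subset hsub hd] with τ hτ
  obtain ⟨v, hv, hle⟩ := hτ
  have h2 := hv.norm_sq
  have h3 : deriv (fun τ => ‖x τ‖ * ‖x τ‖) τ = 2 * inner ℝ (x τ) v := by
    rw [← h2.deriv]
    congr 1
    ext r
    simp [sq]
  rw [h3]
  exact hle

/-! ### Subgradients -/

theorem continuous_of_convexOn_univ {n : ℕ} {R : Euc n → ℝ} (hR : ConvexOn ℝ univ R) :
    Continuous R :=
  continuousOn_univ.1 (hR.continuousOn isOpen_univ)

/-- Hahn–Banach separates the point `(x, R x)` from the open strict epigraph. The vertical component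
`k` of the functional is negative because the epigraph contains points directly above `(x, R x)`;
dividing by `-k` yields a subgradient. -/
theorem subdifferential_nonempty {n : ℕ} {R : Euc n → ℝ} (hR : ConvexOn ℝ univ R) (x : Euc n) :
    (subdifferential R x).Nonempty := by
  have hc := continuous_of_convexOn_univ hR
  have hconv := hR.convex_strict_epigraph
  have hopen : IsOpen {q : Euc n × ℝ | q.1 ∈ univ ∧ R q.1 < q.2} := by
    simpa using isOpen_lt (hc.comp continuous_fst) continuous_snd
  obtain ⟨f, hf⟩ := geometric_hahn_banach_open_point hconv hopen (x := (x, R x)) (by simp)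
  set k := f (0, 1) with hk
  set l : StrongDual ℝ (Euc n) := f.comp (ContinuousLinearMap.inl ℝ (Euc n) ℝ) with hl
  have hfe : ∀ z r, f (z, r) = l z + r * k := by
    intro z r
    have : ((z, r) : Euc n × ℝ) = (z, 0) + r • (0, 1) := by simp
    rw [this, map_add, map_smul]
    simp [hl, hk]
  have hk0 : k < 0 := by
    have := hf (x, R x + 1) (by simp)
    rw [hfe, hfe] at this
    linarith
  have hle : ∀ z, l z + R z * k ≤ l x + R x * k := by
    intro z
    refine le_of_forall_pos_lt_add fun ε hε => ?_
    have := hf (z, R z + ε / (-k)) (by simp [div_pos hε (neg_pos.2 hk0)])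
    rw [hfe, hfe] at this
    have h2 : ε / (-k) * k = -ε := by rw [div_neg, neg_mul, div_mul_cancel₀ _ hk0.ne]
    linarith
  refine ⟨(-k)⁻¹ • (InnerProductSpace.toDual ℝ (Euc n)).symm l, fun z => ?_⟩
  rw [inner_smul_left, InnerProductSpace.toDual_symm_apply, map_sub]
  have := hle z
  have hk' : 0 < -k := neg_pos.2 hk0
  have : (-k)⁻¹ * (l z - l x) ≤ R z - R x := by
    rw [inv_mul_le_iff₀ hk']
    linarith
  simp only [conj_trivial]
  linarith

theorem subdifferential_monotone {n : ℕ} {R : Euc n → ℝ} {x z g k : Euc n}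
    (hg : g ∈ subdifferential R x) (hk : k ∈ subdifferential R z) :
    0 ≤ inner ℝ (g - k) (x - z) := by
  have h1 := hg z
  have h2 := hk x
  have h3 : inner ℝ g (z - x) = - inner ℝ g (x - z) := by rw [← inner_neg_right, neg_sub]
  rw [inner_sub_left]
  linarith

/-! ### Differential inclusions driven by a control -/

/-- The hypotheses on the vector field `Φ` and the weight `c`, both depending on a control `s`
in `S`, that make `0 ∈ x' + Φ(u, x) + c(u) ∂R(x)` well posed. -/
structure FieldBound {n : ℕ} {C : Type*} [TopologicalSpace C] (Φ : C → Euc n → Euc n) (c : C → ℝ)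
    (S : Set C) (L : ℝ) : Prop where
  pos : 0 < L
  continuous_field : Continuous (Function.uncurry Φ)
  continuous_weight : Continuous c
  weight_nonneg : ∀ s ∈ S, 0 ≤ c s
  weight_le : ∀ s ∈ S, c s ≤ L
  norm_le : ∀ s ∈ S, ∀ x, ‖Φ s x‖ ≤ L * (1 + ‖x‖)
  monotone : ∀ s ∈ S, ∀ x z, 0 ≤ inner ℝ (Φ s x - Φ s z) (x - z)

/-- `x` solves `0 ∈ x' + Φ(u, x) + c(u) ∂R(x)`, `x(0) = x₀`, on `[0, T]`. -/
def IsSol {n : ℕ} {C : Type*} (T : ℝ) (R : Euc n → ℝ) (Φ : C → Euc n → Euc n) (c : C → ℝ)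
    (x₀ : Euc n) (u : ℝ → C) (x : ℝ → Euc n) : Prop :=
  AbsolutelyContinuousOnInterval x 0 T ∧ x 0 = x₀ ∧
    ∀ᵐ t ∂timeMeasure T, ∃ v : Euc n, HasDerivAt x v t ∧ ∃ g ∈ subdifferential R (x t),
      v + Φ (u t) (x t) + c (u t) • g = 0

section

variable {n : ℕ} {C : Type*} [TopologicalSpace C] {Φ : C → Euc n → Euc n} {c : C → ℝ}
  {S : Set C} {L M T : ℝ} {R : Euc n → ℝ} {x₀ : Euc n}

theorem aestronglyMeasurable_field (hF : FieldBound Φ c S L) {u : ℝ → C} {x : ℝ → Euc n}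
    {μ : Measure ℝ} (hu : StronglyMeasurable u) (hx : AEStronglyMeasurable x μ) :
    AEStronglyMeasurable (fun t => Φ (u t) (x t)) μ :=
  hF.continuous_field.comp_aestronglyMeasurable (hu.aestronglyMeasurable.prodMk hx)

theorem aestronglyMeasurable_weight (hF : FieldBound Φ c S L) {u : ℝ → C}
    {μ : Measure ℝ} (hu : StronglyMeasurable u) :
    AEStronglyMeasurable (fun t => c (u t)) μ :=
  hF.continuous_weight.comp_aestronglyMeasurable hu.aestronglyMeasurable

/-- The distance between the right-hand sides of two controls along a trajectory `x`. -/
noncomputable def controlGap (Φ : C → Euc n → Euc n) (c : C → ℝ) (G : ℝ) (u u' : ℝ → C) (x : ℝ → Euc n)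
    (t : ℝ) : ℝ :=
  ‖Φ (u t) (x t) - Φ (u' t) (x t)‖ + |c (u t) - c (u' t)| * G

theorem aestronglyMeasurable_controlGap (hF : FieldBound Φ c S L) {u u' : ℝ → C} {x : ℝ → Euc n}
    {μ : Measure ℝ} (hu : StronglyMeasurable u) (hu' : StronglyMeasurable u')
    (hx : AEStronglyMeasurable x μ) (G : ℝ) :
    AEStronglyMeasurable (controlGap Φ c G u u' x) μ :=
  ((aestronglyMeasurable_field hF hu hx).sub (aestronglyMeasurable_field hF hu' hx)).norm.add
    (((aestronglyMeasurable_weight hF hu).sub (aestronglyMeasurable_weight hF hu')).norm.mul_const G)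

theorem controlGap_le (hF : FieldBound Φ c S L) {u u' : ℝ → C} {x : ℝ → Euc n} {t B G : ℝ}
    (hG : 0 ≤ G) (hB : ‖x t‖ ≤ B) (hu : u t ∈ S) (hu' : u' t ∈ S) :
    controlGap Φ c G u u' x t ≤ 2 * L * (1 + B) + L * G := by
  have h1 := hF.norm_le _ hu (x t)
  have h2 := hF.norm_le _ hu' (x t)
  have h3 := norm_sub_le (Φ (u t) (x t)) (Φ (u' t) (x t))
  have h4 : |c (u t) - c (u' t)| ≤ L := by
    rw [abs_le]
    constructor <;> linarith [hF.weight_nonneg _ hu, hF.weight_le _ hu, hF.weight_nonneg _ hu',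
      hF.weight_le _ hu']
  have h5 := mul_le_mul_of_nonneg_right h4 hG
  have h6 := mul_le_mul_of_nonneg_left hB hF.pos.le
  unfold controlGap
  linarith

theorem integrableOn_controlGap (hF : FieldBound Φ c S L) {u u' : ℝ → C} {x : ℝ → Euc n} {G : ℝ}
    (hG : 0 ≤ G) (hu : StronglyMeasurable u) (hu' : StronglyMeasurable u')
    (hx : ContinuousOn x (Icc 0 T)) (huS : ∀ᵐ t ∂timeMeasure T, u t ∈ S)
    (huS' : ∀ᵐ t ∂timeMeasure T, u' t ∈ S) :
    IntegrableOn (controlGap Φ c G u u' x) (Icc 0 T) := by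
  obtain ⟨B, hB⟩ := isCompact_Icc.exists_bound_of_continuousOn hx
  refine Integrable.of_bound
    (aestronglyMeasurable_controlGap hF hu hu' (hx.aestronglyMeasurable measurableSet_Icc) G)
    (2 * L * (1 + B) + L * G) ?_
  filter_upwards [huS, huS', ae_restrict_mem measurableSet_Icc] with t h1 h2 h3
  rw [Real.norm_of_nonneg (by unfold controlGap; positivity)]
  exact controlGap_le hF hG (hB t h3) h1 h2

/-- Stability of the solution with respect to the control. -/
theorem norm_sub_le_integral_controlGap (hF : FieldBound Φ c S L) (hT : 0 ≤ T)
    (hM : 0 ≤ M) (hsub : ∀ x, ∀ g ∈ subdifferential R x, ‖g‖ ≤ M * (1 + ‖x‖))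
    {u u' : ℝ → C} {x x' : ℝ → Euc n} {B : ℝ}
    (hu : StronglyMeasurable u) (hu' : StronglyMeasurable u')
    (huS : ∀ᵐ t ∂timeMeasure T, u t ∈ S) (huS' : ∀ᵐ t ∂timeMeasure T, u' t ∈ S)
    (hx : IsSol T R Φ c x₀ u x) (hx' : IsSol T R Φ c x₀ u' x')
    (hB : ∀ t ∈ Icc 0 T, ‖x' t‖ ≤ B) {t : ℝ} (ht : t ∈ Icc 0 T) :
    ‖x t - x' t‖ ≤ 2 * ∫ τ in Icc 0 T, controlGap Φ c (M * (1 + B)) u u' x' τ := by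
  have hB0 : 0 ≤ B := (norm_nonneg _).trans (hB 0 ⟨le_rfl, hT⟩)
  have hG : 0 ≤ M * (1 + B) := by positivity
  set δ := controlGap Φ c (M * (1 + B)) u u' x' with hδ
  have hδ0 : ∀ τ, 0 ≤ δ τ := fun τ => by rw [hδ]; unfold controlGap; positivity
  obtain ⟨hac, h0, hd⟩ := hx
  obtain ⟨hac', h0', hd'⟩ := hx'
  have hc' : ContinuousOn x' (Icc 0 T) := by simpa [uIcc_of_le hT] using hac'.continuousOn
  have hc : ContinuousOn x (Icc 0 T) := by simpa [uIcc_of_le hT] using hac.continuousOn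
  have hint : IntegrableOn δ (Icc 0 T) := integrableOn_controlGap hF hG hu hu' hc' huS huS'
  -- Evaluating at the maximum `m` of the distance replaces Gronwall: the energy estimate becomes
  -- `m² ≤ 2 m ∫ δ`, and `m` cancels.
  obtain ⟨t₀, ht₀, hmax⟩ := isCompact_Icc.exists_isMaxOn (nonempty_Icc.2 hT)
    (hc.sub hc').norm
  set m := ‖x t₀ - x' t₀‖ with hm
  have hmle : ∀ τ ∈ Icc 0 T, ‖x τ - x' τ‖ ≤ m := fun τ hτ => hmax hτ
  have key := norm_sq_sub_le_integral (x := fun τ => x τ - x' τ) (ρ := fun τ => 2 * m * δ τ)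
    (hac.fun_sub hac') (hint.const_mul _) (by
      filter_upwards [hd, hd', huS, huS', ae_restrict_mem measurableSet_Icc] with τ h1 h2 h3 h4 h5
      obtain ⟨v, hv, g, hg, hvg⟩ := h1
      obtain ⟨v', hv', g', hg', hvg'⟩ := h2
      refine ⟨v - v', hv.sub hv', ?_⟩
      have e1 : v = -(Φ (u τ) (x τ) + c (u τ) • g) := by
        rw [eq_neg_iff_add_eq_zero, ← hvg]; abel
      have e2 : v' = -(Φ (u' τ) (x' τ) + c (u' τ) • g') := by
        rw [eq_neg_iff_add_eq_zero, ← hvg']; abel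
      set w := x τ - x' τ with hw
      -- Inserting `Φ (u τ) (x' τ)` and `c (u τ) • g'` splits off two monotone terms. The remainder
      -- is evaluated along `x'` only, so a bound on `x'` suffices.
      have e3 : v - v' = -((Φ (u τ) (x τ) - Φ (u τ) (x' τ)) + c (u τ) • (g - g')
          + ((Φ (u τ) (x' τ) - Φ (u' τ) (x' τ)) + (c (u τ) - c (u' τ)) • g')) := by
        rw [e1, e2]; module
      have m1 := hF.monotone _ h3 (x τ) (x' τ)
      have m2 := mul_nonneg (hF.weight_nonneg _ h3) (subdifferential_monotone hg hg')
      have m3 : ‖(Φ (u τ) (x' τ) - Φ (u' τ) (x' τ)) + (c (u τ) - c (u' τ)) • g'‖ ≤ δ τ := by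
        refine (norm_add_le _ _).trans ?_
        rw [norm_smul, Real.norm_eq_abs]
        have : ‖g'‖ ≤ M * (1 + B) := (hsub _ _ hg').trans (by gcongr; exact hB τ h5)
        rw [hδ]; unfold controlGap
        gcongr
      have m4 := abs_le.1 (abs_real_inner_le_norm
        ((Φ (u τ) (x' τ) - Φ (u' τ) (x' τ)) + (c (u τ) - c (u' τ)) • g') w)
      have m5 : ‖(Φ (u τ) (x' τ) - Φ (u' τ) (x' τ)) + (c (u τ) - c (u' τ)) • g'‖ * ‖w‖
          ≤ δ τ * m := mul_le_mul m3 (hmle τ h5) (norm_nonneg _) (hδ0 τ)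
      rw [real_inner_comm, e3, inner_neg_left, inner_add_left, inner_add_left, real_inner_smul_left]
      nlinarith [m4.1])
    le_rfl ht₀.1 ht₀.2
  have h0sub : x 0 - x' 0 = 0 := by rw [h0, h0', sub_self]
  simp only [h0sub, norm_zero] at key
  rw [intervalIntegral.integral_const_mul, intervalIntegral.integral_of_le ht₀.1,
    ← integral_Icc_eq_integral_Ioc, ← hm] at key
  have hI : ∫ τ in Icc 0 t₀, δ τ ≤ ∫ τ in Icc 0 T, δ τ :=
    setIntegral_mono_set hint (Eventually.of_forall hδ0)
      (Icc_subset_Icc le_rfl ht₀.2).eventuallyLE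
  refine (hmle t ht).trans ?_
  rcases (norm_nonneg (x t₀ - x' t₀)).eq_or_lt with h | h
  · rw [hm, ← h]
    exact mul_nonneg zero_le_two (integral_nonneg hδ0)
  · rw [← hm] at h
    by_contra hcon
    push Not at hcon
    nlinarith

theorem IsSol.eqOn (hF : FieldBound Φ c S L) (hT : 0 ≤ T)
    (hM : 0 ≤ M) (hsub : ∀ x, ∀ g ∈ subdifferential R x, ‖g‖ ≤ M * (1 + ‖x‖))
    {u : ℝ → C} {x x' : ℝ → Euc n} (hu : StronglyMeasurable u)
    (huS : ∀ᵐ t ∂timeMeasure T, u t ∈ S)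
    (hx : IsSol T R Φ c x₀ u x) (hx' : IsSol T R Φ c x₀ u x') : EqOn x x' (Icc 0 T) := by
  obtain ⟨B, hB⟩ := hx'.1.exists_bound
  rw [uIcc_of_le hT] at hB
  intro t ht
  have := norm_sub_le_integral_controlGap hF hT hM hsub hu hu huS huS hx hx' hB ht
  simp only [controlGap, sub_self, norm_zero, abs_zero, zero_mul, add_zero, integral_zero,
    mul_zero] at this
  exact sub_eq_zero.1 (norm_le_zero_iff.1 this)

/-- Solutions depend continuously on the control with respect to convergence a.e. -/
theorem tendsto_of_tendsto_control_ae (hF : FieldBound Φ c S L) (hT : 0 ≤ T)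
    (hM : 0 ≤ M) (hsub : ∀ x, ∀ g ∈ subdifferential R x, ‖g‖ ≤ M * (1 + ‖x‖))
    {u : ℕ → ℝ → C} {u' : ℝ → C} {x : ℕ → ℝ → Euc n} {x' : ℝ → Euc n}
    (hu : ∀ k, StronglyMeasurable (u k)) (hu' : StronglyMeasurable u')
    (huS : ∀ k, ∀ᵐ t ∂timeMeasure T, u k t ∈ S) (huS' : ∀ᵐ t ∂timeMeasure T, u' t ∈ S)
    (hx : ∀ k, IsSol T R Φ c x₀ (u k) (x k)) (hx' : IsSol T R Φ c x₀ u' x')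
    (hlim : ∀ᵐ t ∂timeMeasure T, Tendsto (fun k => u k t) atTop (𝓝 (u' t)))
    {t : ℝ} (ht : t ∈ Icc 0 T) :
    Tendsto (fun k => x k t) atTop (𝓝 (x' t)) := by
  obtain ⟨B, hB⟩ := hx'.1.exists_bound
  have hc' : ContinuousOn x' (Icc 0 T) := by simpa [uIcc_of_le hT] using hx'.1.continuousOn
  rw [uIcc_of_le hT] at hB
  have hB0 : 0 ≤ B := (norm_nonneg _).trans (hB 0 ⟨le_rfl, hT⟩)
  have hG : 0 ≤ M * (1 + B) := by positivity
  rw [tendsto_iff_norm_sub_tendsto_zero]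
  refine squeeze_zero (fun _ => norm_nonneg _) (fun k => norm_sub_le_integral_controlGap hF hT hM
    hsub (hu k) hu' (huS k) huS' (hx k) hx' hB ht) ?_
  -- The gap is taken along the fixed limit trajectory, so dominated convergence needs no uniform
  -- bound on the states `x k`.
  have : Tendsto (fun k => ∫ τ in Icc 0 T, controlGap Φ c (M * (1 + B)) (u k) u' x' τ) atTop
      (𝓝 (∫ τ in Icc 0 T, (0 : ℝ))) := by
    refine tendsto_integral_of_dominated_convergence
      (fun _ => 2 * L * (1 + B) + L * (M * (1 + B)))
      (fun k => aestronglyMeasurable_controlGap hF (hu k) hu'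
        (hc'.aestronglyMeasurable measurableSet_Icc) _)
      (integrable_const _) (fun k => ?_) ?_
    · filter_upwards [huS k, huS', ae_restrict_mem measurableSet_Icc] with t h1 h2 h3
      rw [Real.norm_of_nonneg (by unfold controlGap; positivity)]
      exact controlGap_le hF hG (hB t h3) h1 h2
    · filter_upwards [hlim] with t ht
      have h1 : Tendsto (fun k => Φ (u k t) (x' t)) atTop (𝓝 (Φ (u' t) (x' t))) :=
        (hF.continuous_field.tendsto (u' t, x' t)).comp (ht.prodMk_nhds tendsto_const_nhds)
      have h2 := (hF.continuous_weight.tendsto (u' t)).comp ht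
      simpa [controlGap] using (h1.sub_const (Φ (u' t) (x' t))).norm.add
        ((h2.sub_const (c (u' t))).abs.mul_const (M * (1 + B)))
  simpa using this.const_mul 2

end

/-! ### The explicit Euler scheme -/

section Euler

variable {E : Type*} [NormedAddCommGroup E] [NormedSpace ℝ E]

/-- The nodes of the explicit Euler scheme with step size `h` for `x' = -V(x, s)`, with the
vector field averaged over each time step. -/
noncomputable def eulerNode (V : E → ℝ → E) (x₀ : E) (h : ℝ) : ℕ → E
  | 0 => x₀
  | k + 1 => eulerNode V x₀ h k -
      ∫ s in (k * h)..((k + 1 : ℕ) * h), V (eulerNode V x₀ h k) s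

/-- The piecewise constant interpolation of the Euler nodes. -/
noncomputable def eulerStep (V : E → ℝ → E) (x₀ : E) (h s : ℝ) : E :=
  eulerNode V x₀ h ⌊s / h⌋₊

/-- The continuous interpolation of the Euler nodes. -/
noncomputable def eulerCurve (V : E → ℝ → E) (x₀ : E) (h t : ℝ) : E :=
  x₀ - ∫ s in (0 : ℝ)..t, V (eulerStep V x₀ h s) s

variable {V : E → ℝ → E} {x₀ : E} {h Λ T : ℝ}

/-- The step function factors through the discrete space `ℕ`, so `f` may be arbitrary. This permits
a selection of subgradients with no measurability. -/
theorem stronglyMeasurable_comp_eulerStep {F : Type*} [TopologicalSpace F]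
    [TopologicalSpace.PseudoMetrizableSpace F] (f : E → F) :
    StronglyMeasurable (fun s => f (eulerStep V x₀ h s)) := by
  have h1 : Measurable (fun s : ℝ => ⌊s / h⌋₊) := Nat.measurable_floor.comp (measurable_id.div_const h)
  have h2 : StronglyMeasurable (fun k : ℕ => f (eulerNode V x₀ h k)) :=
    StronglyMeasurable.of_discrete
  exact h2.comp_measurable h1

/-- Discrete Gronwall: each step multiplies `1 + ‖·‖` by at most `1 + Λ h ≤ exp (Λ h)`. -/
theorem norm_eulerNode_le (hh : 0 ≤ h) (hV : ∀ x s, ‖V x s‖ ≤ Λ * (1 + ‖x‖)) (k : ℕ) :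
    1 + ‖eulerNode V x₀ h k‖ ≤ Real.exp (Λ * (k * h)) * (1 + ‖x₀‖) := by
  induction k with
  | zero => simp [eulerNode]
  | succ k ih =>
    have h1 : ‖∫ s in (k * h)..((k + 1 : ℕ) * h), V (eulerNode V x₀ h k) s‖
        ≤ Λ * (1 + ‖eulerNode V x₀ h k‖) * |((k + 1 : ℕ) * h) - k * h| :=
      intervalIntegral.norm_integral_le_of_norm_le_const fun s _ => hV _ s
    have h2 : |(((k + 1 : ℕ) : ℝ) * h) - k * h| = h := by
      rw [← sub_mul]; push_cast; rw [add_sub_cancel_left, one_mul, abs_of_nonneg hh]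
    rw [h2] at h1
    have h3 := norm_sub_le (eulerNode V x₀ h k)
      (∫ s in (k * h)..((k + 1 : ℕ) * h), V (eulerNode V x₀ h k) s)
    calc 1 + ‖eulerNode V x₀ h (k + 1)‖
        ≤ (Λ * h + 1) * (1 + ‖eulerNode V x₀ h k‖) := by
          rw [eulerNode]; linarith
      _ ≤ Real.exp (Λ * h) * (1 + ‖eulerNode V x₀ h k‖) := by
          gcongr; exact Real.add_one_le_exp _
      _ ≤ Real.exp (Λ * h) * (Real.exp (Λ * (k * h)) * (1 + ‖x₀‖)) := by gcongr
      _ = _ := by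
          rw [← mul_assoc, ← Real.exp_add]; push_cast; ring_nf

theorem norm_eulerStep_le (hh : 0 < h) (hΛ : 0 ≤ Λ) (hV : ∀ x s, ‖V x s‖ ≤ Λ * (1 + ‖x‖))
    {s : ℝ} (hs : 0 ≤ s) (hsT : s ≤ T) :
    1 + ‖eulerStep V x₀ h s‖ ≤ Real.exp (Λ * T) * (1 + ‖x₀‖) := by
  refine (norm_eulerNode_le hh.le hV _).trans ?_
  have : (⌊s / h⌋₊ : ℝ) * h ≤ T :=
    ((le_div_iff₀ hh).1 (Nat.floor_le (div_nonneg hs hh.le))).trans hsT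
  gcongr

theorem norm_apply_eulerStep_le (hh : 0 < h) (hΛ : 0 ≤ Λ)
    (hV : ∀ x s, ‖V x s‖ ≤ Λ * (1 + ‖x‖)) {s : ℝ} (hs : 0 ≤ s) (hsT : s ≤ T) :
    ‖V (eulerStep V x₀ h s) s‖ ≤ Λ * (Real.exp (Λ * T) * (1 + ‖x₀‖)) :=
  (hV _ _).trans (mul_le_mul_of_nonneg_left (norm_eulerStep_le hh hΛ hV hs hsT) hΛ)

theorem intervalIntegrable_apply_eulerStep (hh : 0 < h) (hΛ : 0 ≤ Λ)
    (hV : ∀ x s, ‖V x s‖ ≤ Λ * (1 + ‖x‖))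
    (hm : StronglyMeasurable fun s => V (eulerStep V x₀ h s) s) {s t : ℝ} (hs : 0 ≤ s)
    (ht : 0 ≤ t) : IntervalIntegrable (fun s => V (eulerStep V x₀ h s) s) volume s t := by
  have : ∀ r, 0 ≤ r → IntervalIntegrable (fun s => V (eulerStep V x₀ h s) s) volume 0 r := by
    intro r hr
    rw [intervalIntegrable_iff_integrableOn_Icc_of_le hr]
    refine Integrable.of_bound hm.aestronglyMeasurable (Λ * (Real.exp (Λ * r) * (1 + ‖x₀‖))) ?_
    filter_upwards [ae_restrict_mem measurableSet_Icc] with τ hτ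
    exact norm_apply_eulerStep_le hh hΛ hV hτ.1 hτ.2
  exact (this s hs).symm.trans (this t ht)

theorem eulerCurve_sub (hh : 0 < h) (hΛ : 0 ≤ Λ) (hV : ∀ x s, ‖V x s‖ ≤ Λ * (1 + ‖x‖))
    (hm : StronglyMeasurable fun s => V (eulerStep V x₀ h s) s) {s t : ℝ} (hs : 0 ≤ s)
    (ht : 0 ≤ t) : eulerCurve V x₀ h t - eulerCurve V x₀ h s =
      -∫ r in s..t, V (eulerStep V x₀ h r) r := by
  unfold eulerCurve
  rw [← intervalIntegral.integral_add_adjacent_intervals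
    (intervalIntegrable_apply_eulerStep hh hΛ hV hm le_rfl hs)
    (intervalIntegrable_apply_eulerStep hh hΛ hV hm hs ht)]
  abel

theorem eulerCurve_node (hh : 0 < h) (hΛ : 0 ≤ Λ) (hV : ∀ x s, ‖V x s‖ ≤ Λ * (1 + ‖x‖))
    (hm : StronglyMeasurable fun s => V (eulerStep V x₀ h s) s) (k : ℕ) :
    eulerCurve V x₀ h (k * h) = eulerNode V x₀ h k := by
  induction k with
  | zero => simp [eulerCurve, eulerNode]
  | succ k ih =>
    have h1 := eulerCurve_sub (x₀ := x₀) hh hΛ hV hm (s := k * h) (t := (k + 1 : ℕ) * h)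
      (by positivity) (by positivity)
    rw [ih, sub_eq_iff_eq_add] at h1
    rw [h1, eulerNode, sub_eq_neg_add]
    congr 2
    refine intervalIntegral.integral_congr_ae ?_
    -- At the right endpoint the floor already jumps to `k + 1`; a single point is negligible.
    have hne : ∀ᵐ r : ℝ, r ≠ (k + 1 : ℕ) * h := by simp [ae_iff, measure_singleton]
    filter_upwards [hne] with r hr hmem
    have hlt : (k : ℝ) * h ≤ (k + 1 : ℕ) * h := by push_cast; nlinarith
    rw [uIoc_of_le hlt] at hmem
    have : ⌊r / h⌋₊ = k := by
      rw [Nat.floor_eq_iff (div_nonneg ((by positivity : (0 : ℝ) ≤ k * h).trans hmem.1.le) hh.le),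
        le_div_iff₀ hh, div_lt_iff₀ hh]
      refine ⟨hmem.1.le, ?_⟩
      have := lt_of_le_of_ne hmem.2 hr
      push_cast at this
      exact this
    simp only [eulerStep, this]

theorem norm_eulerCurve_sub_le (hh : 0 < h) (hΛ : 0 ≤ Λ) (hV : ∀ x s, ‖V x s‖ ≤ Λ * (1 + ‖x‖))
    (hm : StronglyMeasurable fun s => V (eulerStep V x₀ h s) s) {s t : ℝ}
    (hs : s ∈ Icc 0 T) (ht : t ∈ Icc 0 T) :
    ‖eulerCurve V x₀ h t - eulerCurve V x₀ h s‖
      ≤ Λ * (Real.exp (Λ * T) * (1 + ‖x₀‖)) * |t - s| := by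
  rw [eulerCurve_sub hh hΛ hV hm hs.1 ht.1, norm_neg]
  refine intervalIntegral.norm_integral_le_of_norm_le_const fun r hr => ?_
  have hr' := uIcc_subset_Icc hs ht (uIoc_subset_uIcc hr)
  exact norm_apply_eulerStep_le hh hΛ hV hr'.1 hr'.2

theorem norm_eulerCurve_sub_eulerStep_le (hh : 0 < h) (hΛ : 0 ≤ Λ)
    (hV : ∀ x s, ‖V x s‖ ≤ Λ * (1 + ‖x‖))
    (hm : StronglyMeasurable fun s => V (eulerStep V x₀ h s) s) {t : ℝ} (ht : t ∈ Icc 0 T) :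
    ‖eulerCurve V x₀ h t - eulerStep V x₀ h t‖
      ≤ Λ * (Real.exp (Λ * T) * (1 + ‖x₀‖)) * h := by
  have h1 : (⌊t / h⌋₊ : ℝ) * h ≤ t := (le_div_iff₀ hh).1 (Nat.floor_le (div_nonneg ht.1 hh.le))
  have h2 : t < (⌊t / h⌋₊ + 1 : ℝ) * h := (div_lt_iff₀ hh).1 (Nat.lt_floor_add_one _)
  rw [eulerStep, ← eulerCurve_node hh hΛ hV hm]
  refine (norm_eulerCurve_sub_le hh hΛ hV hm ⟨by positivity, h1.trans ht.2⟩ ht).trans ?_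
  have : |t - ⌊t / h⌋₊ * h| ≤ h := by rw [abs_of_nonneg (by linarith)]; linarith
  gcongr

theorem eulerCurve_lipschitzOnWith (hh : 0 < h) (hΛ : 0 ≤ Λ)
    (hV : ∀ x s, ‖V x s‖ ≤ Λ * (1 + ‖x‖))
    (hm : StronglyMeasurable fun s => V (eulerStep V x₀ h s) s) :
    LipschitzOnWith (Λ * (Real.exp (Λ * T) * (1 + ‖x₀‖))).toNNReal (eulerCurve V x₀ h)
      (Icc 0 T) := by
  refine LipschitzOnWith.of_dist_le_mul fun t ht s hs => ?_
  rw [dist_eq_norm, Real.dist_eq, Real.coe_toNNReal _ (by positivity)]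
  exact norm_eulerCurve_sub_le hh hΛ hV hm hs ht

theorem eulerCurve_absolutelyContinuousOnInterval (hT : 0 ≤ T) (hh : 0 < h) (hΛ : 0 ≤ Λ)
    (hV : ∀ x s, ‖V x s‖ ≤ Λ * (1 + ‖x‖))
    (hm : StronglyMeasurable fun s => V (eulerStep V x₀ h s) s) :
    AbsolutelyContinuousOnInterval (eulerCurve V x₀ h) 0 T := by
  have := eulerCurve_lipschitzOnWith (T := T) hh hΛ hV hm
  rw [← uIcc_of_le hT] at this
  exact this.absolutelyContinuousOnInterval

theorem eulerCurve_ae_hasDerivAt [CompleteSpace E] (hT : 0 ≤ T) (hh : 0 < h) (hΛ : 0 ≤ Λ)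
    (hV : ∀ x s, ‖V x s‖ ≤ Λ * (1 + ‖x‖))
    (hm : StronglyMeasurable fun s => V (eulerStep V x₀ h s) s) :
    ∀ᵐ t ∂timeMeasure T,
      HasDerivAt (eulerCurve V x₀ h) (-V (eulerStep V x₀ h t) t) t := by
  have := (intervalIntegrable_apply_eulerStep hh hΛ hV hm le_rfl hT).ae_hasDerivAt_integral
  rw [uIcc_of_le hT] at this
  rw [ae_restrict_iff' measurableSet_Icc]
  filter_upwards [this] with t ht hmem
  exact (ht hmem 0 ⟨le_rfl, hT⟩).const_sub x₀

end Euler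

theorem IsSol.congr_control {n : ℕ} {C : Type*} {Φ : C → Euc n → Euc n} {c : C → ℝ} {T : ℝ}
    {R : Euc n → ℝ} {x₀ : Euc n} {u u' : ℝ → C} {x : ℝ → Euc n} (h : u =ᵐ[timeMeasure T] u')
    (hx : IsSol T R Φ c x₀ u x) : IsSol T R Φ c x₀ u' x := by
  refine ⟨hx.1, hx.2.1, ?_⟩
  filter_upwards [hx.2.2, h] with t h1 h2
  rwa [← h2]

/-! ### The integrated variational inequality -/

section

variable {n : ℕ} {C : Type*} [TopologicalSpace C] {Φ : C → Euc n → Euc n} {c : C → ℝ}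
  {S : Set C} {L M T : ℝ} {R : Euc n → ℝ} {x₀ : Euc n} {u : ℝ → C}

/-- The right-hand side of the variational inequality `d/dt ‖x - z‖² ≤ …` characterizing
solutions. -/
noncomputable def variationalRate (Φ : C → Euc n → Euc n) (c : C → ℝ) (R : Euc n → ℝ)
    (u : ℝ → C) (z : Euc n) (X : ℝ → Euc n) (t : ℝ) : ℝ :=
  2 * (c (u t) * (R z - R (X t)) - inner ℝ (Φ (u t) (X t)) (X t - z))

theorem aestronglyMeasurable_variationalRate (hF : FieldBound Φ c S L) (hR : Continuous R)
    (hu : StronglyMeasurable u) (z : Euc n) {X : ℝ → Euc n} {μ : Measure ℝ}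
    (hX : AEStronglyMeasurable X μ) :
    AEStronglyMeasurable (variationalRate Φ c R u z X) μ :=
  (((aestronglyMeasurable_weight hF hu).mul
    (aestronglyMeasurable_const.sub (hR.comp_aestronglyMeasurable hX))).sub
    ((aestronglyMeasurable_field hF hu hX).inner
      (hX.sub aestronglyMeasurable_const))).const_mul 2

/-- The bound is uniform in the control and the curve, so it can serve as the dominating constant
along the Euler approximations. Compactness of the ball bounds `R`. -/
theorem exists_bound_variationalRate (hF : FieldBound Φ c S L) (hR : Continuous R)
    (B : ℝ) (z : Euc n) : ∃ K, ∀ (u : ℝ → C) (X : ℝ → Euc n) (t : ℝ), u t ∈ S → ‖X t‖ ≤ B →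
      ‖variationalRate Φ c R u z X t‖ ≤ K := by
  obtain ⟨ρ, hρ⟩ := (isCompact_closedBall (0 : Euc n) B).exists_bound_of_continuousOn
    (continuous_const.sub hR : Continuous fun q => R z - R q).continuousOn
  refine ⟨2 * (L * ρ + (L * (1 + B)) * (B + ‖z‖)), fun u X t hu hX => ?_⟩
  have hB : 0 ≤ B := (norm_nonneg _).trans hX
  have hL := hF.pos.le
  rw [variationalRate, norm_mul, Real.norm_ofNat]
  gcongr
  refine (norm_sub_le _ _).trans (add_le_add ?_ ?_)
  · rw [norm_mul, Real.norm_of_nonneg (hF.weight_nonneg _ hu)]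
    exact mul_le_mul (hF.weight_le _ hu) (hρ _ (by simpa using hX)) (norm_nonneg _) hL
  · refine (norm_inner_le_norm _ _).trans (mul_le_mul ((hF.norm_le _ hu _).trans ?_)
      ((norm_sub_le _ _).trans ?_) (norm_nonneg _) (by positivity))
    · gcongr
    · gcongr

theorem integrableOn_variationalRate (hF : FieldBound Φ c S L) (hR : Continuous R)
    (hu : StronglyMeasurable u) (huS : ∀ t, u t ∈ S) (z : Euc n) {X : ℝ → Euc n} {B : ℝ}
    (hX : AEStronglyMeasurable X (timeMeasure T)) (hB : ∀ t ∈ Icc 0 T, ‖X t‖ ≤ B) :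
    IntegrableOn (variationalRate Φ c R u z X) (Icc 0 T) := by
  obtain ⟨K, hK⟩ := exists_bound_variationalRate (z := z) hF hR B
  refine Integrable.of_bound (aestronglyMeasurable_variationalRate hF hR hu z hX) K ?_
  filter_upwards [ae_restrict_mem measurableSet_Icc] with t ht
  exact hK u X t (huS t) (hB t ht)

/-- A Lipschitz curve satisfying the integrated variational inequality is a solution. -/
theorem isSol_of_variational (hF : FieldBound Φ c S L) (hT : 0 ≤ T) (hR : ConvexOn ℝ univ R)
    (hu : StronglyMeasurable u) (huS : ∀ t, u t ∈ S) {x : ℝ → Euc n} {K : NNReal}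
    (hx : LipschitzOnWith K x (Icc 0 T)) (hx0 : x 0 = x₀)
    (hvar : ∀ z, ∀ s t, 0 ≤ s → s ≤ t → t ≤ T →
      ‖x t - z‖ ^ 2 - ‖x s - z‖ ^ 2 ≤ ∫ τ in s..t, variationalRate Φ c R u z x τ) :
    IsSol T R Φ c x₀ u x := by
  have hRc := continuous_of_convexOn_univ hR
  refine ⟨LipschitzOnWith.absolutelyContinuousOnInterval (by rwa [uIcc_of_le hT]), hx0, ?_⟩
  obtain ⟨B, hB⟩ := isCompact_Icc.exists_bound_of_continuousOn hx.continuousOn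
  have hxm : AEStronglyMeasurable x (timeMeasure T) :=
    hx.continuousOn.aestronglyMeasurable measurableSet_Icc
  have hint : ∀ z, IntervalIntegrable (variationalRate Φ c R u z x) volume 0 T := fun z =>
    (intervalIntegrable_iff_integrableOn_Icc_of_le hT).2
      (integrableOn_variationalRate hF hRc hu huS z hxm hB)
  -- Restricting the test points to a countable dense set gives a single null set of times valid for
  -- all of them.
  have hder : ∀ᵐ t ∂timeMeasure T, ∀ k : ℕ,
      HasDerivAt (fun r => ∫ τ in (0 : ℝ)..r, variationalRate Φ c R u (TopologicalSpace.denseSeq _ k) x τ)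
        (variationalRate Φ c R u (TopologicalSpace.denseSeq _ k) x t) t := by
    rw [ae_all_iff]
    intro k
    have := (hint (TopologicalSpace.denseSeq _ k)).ae_hasDerivAt_integral
    rw [uIcc_of_le hT] at this
    rw [ae_restrict_iff' measurableSet_Icc]
    filter_upwards [this] with t ht hmem
    exact ht hmem 0 ⟨le_rfl, hT⟩
  have hne0 : ∀ᵐ t ∂timeMeasure T, t ≠ 0 :=
    ae_restrict_of_ae (by simp [ae_iff, measure_singleton])
  have hneT : ∀ᵐ t ∂timeMeasure T, t ≠ T :=
    ae_restrict_of_ae (by simp [ae_iff, measure_singleton])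
  filter_upwards [hder, hx.ae_differentiableWithinAt_real measurableSet_Icc, hne0, hneT,
    ae_restrict_mem measurableSet_Icc] with t h1 h2 h3 h4 h5
  have hnhds : Icc 0 T ∈ 𝓝 t :=
    Icc_mem_nhds (lt_of_le_of_ne h5.1 (Ne.symm h3)) (lt_of_le_of_ne h5.2 h4)
  have hv := (h2.differentiableAt hnhds).hasDerivAt
  set v := deriv x t with hvdef
  have hdense : ∀ k : ℕ, 2 * inner ℝ (x t - TopologicalSpace.denseSeq (Euc n) k) v
      ≤ variationalRate Φ c R u (TopologicalSpace.denseSeq _ k) x t := by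
    intro k
    set z := TopologicalSpace.denseSeq (Euc n) k with hz
    have hd := (h1 k).sub ((hv.sub_const z).norm_sq)
    -- The integrated inequality says exactly that this difference is nondecreasing; its derivative
    -- at `t` is then nonnegative.
    have hmono : MonotoneOn ((fun r => ∫ τ in (0 : ℝ)..r, variationalRate Φ c R u z x τ)
        - (‖x · - z‖ ^ 2)) (Icc 0 T) := by
      intro a ha b hb hab
      have h6 := hvar z a b ha.1 hab hb.2
      have h7 := intervalIntegral.integral_add_adjacent_intervals
        ((hint z).mono_set (c := 0) (d := a) (by
          rw [uIcc_of_le hT, uIcc_of_le ha.1]; exact Icc_subset_Icc le_rfl ha.2))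
        ((hint z).mono_set (c := a) (d := b) (by
          rw [uIcc_of_le hT, uIcc_of_le hab]; exact Icc_subset_Icc ha.1 hb.2))
      simp only [Pi.sub_apply]
      linarith
    have := (hmono.derivWithin_nonneg (x := t))
    rw [derivWithin_of_mem_nhds hnhds, hd.deriv] at this
    linarith
  have hall : ∀ z, 2 * inner ℝ (x t - z) v ≤ variationalRate Φ c R u z x t := by
    have hcl : IsClosed {z | 2 * inner ℝ (x t - z) v ≤ variationalRate Φ c R u z x t} := by
      refine isClosed_le (by fun_prop) ?_
      unfold variationalRate
      fun_prop
    intro z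
    have := hcl.closure_subset_iff.2 (range_subset_iff.2 hdense)
    rw [(TopologicalSpace.denseRange_denseSeq (Euc n)).closure_eq] at this
    exact this (mem_univ z)
  refine ⟨v, hv, ?_⟩
  set w := v + Φ (u t) (x t) with hw
  have hall' : ∀ z, -inner ℝ w (z - x t) ≤ c (u t) * (R z - R (x t)) := by
    intro z
    have := hall z
    rw [variationalRate] at this
    have e : inner ℝ w (z - x t) = -(inner ℝ (x t - z) v + inner ℝ (Φ (u t) (x t)) (x t - z)) := by
      rw [hw, inner_add_left, ← neg_sub (x t) z, inner_neg_right, inner_neg_right,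
        real_inner_comm v]
      ring
    rw [e]
    linarith
  -- If the weight vanishes, the test point `x t - w` forces `w = 0` and any subgradient will do.
  -- Otherwise `-w / c` is itself a subgradient.
  rcases (hF.weight_nonneg _ (huS t)).eq_or_lt with hc0 | hc0
  · obtain ⟨g, hg⟩ := subdifferential_nonempty hR (x t)
    refine ⟨g, hg, ?_⟩
    have := hall' (x t - w)
    rw [← hc0, sub_sub_cancel_left, inner_neg_right, real_inner_self_eq_norm_sq] at this
    have hw0 : ‖w‖ ^ 2 ≤ 0 := by linarith
    have hw1 : w = 0 := norm_eq_zero.1 (pow_eq_zero_iff two_ne_zero |>.1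
      (le_antisymm hw0 (sq_nonneg _)))
    rw [← hc0, hw1, zero_smul, add_zero]
  · refine ⟨-((c (u t))⁻¹ • w), fun z => ?_, ?_⟩
    · have := hall' z
      rw [inner_neg_left, real_inner_smul_left]
      have h8 : (c (u t))⁻¹ * -inner ℝ w (z - x t) ≤ R z - R (x t) := by
        rwa [inv_mul_le_iff₀ hc0]
      linarith
    · rw [smul_neg, smul_inv_smul₀ hc0.ne', add_neg_cancel]

/-! ### Existence of solutions -/

theorem exists_isSol_of_forall_mem (hF : FieldBound Φ c S L) (hT : 0 ≤ T)
    (hR : ConvexOn ℝ univ R) (hM : 0 ≤ M)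
    (hsub : ∀ x, ∀ g ∈ subdifferential R x, ‖g‖ ≤ M * (1 + ‖x‖))
    (hu : StronglyMeasurable u) (huS : ∀ t, u t ∈ S) :
    ∃ x, IsSol T R Φ c x₀ u x := by
  have hRc := continuous_of_convexOn_univ hR
  choose γ hγ using subdifferential_nonempty hR
  have hL := hF.pos.le
  set Λ := L + L * M with hΛdef
  have hΛ : 0 ≤ Λ := by positivity
  set V : Euc n → ℝ → Euc n := fun X s => Φ (u s) X + c (u s) • γ X with hVdef
  have hV : ∀ x s, ‖V x s‖ ≤ Λ * (1 + ‖x‖) := by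
    intro x s
    refine (norm_add_le _ _).trans ?_
    rw [norm_smul, Real.norm_of_nonneg (hF.weight_nonneg _ (huS s)), hΛdef, add_mul, mul_assoc]
    exact add_le_add (hF.norm_le _ (huS s) x) (mul_le_mul (hF.weight_le _ (huS s))
      (hsub _ _ (hγ x)) (norm_nonneg _) hL)
  have hstep : ∀ h, StronglyMeasurable (eulerStep V x₀ h) := fun h =>
    stronglyMeasurable_comp_eulerStep id
  have hm : ∀ h, StronglyMeasurable fun s => V (eulerStep V x₀ h s) s := fun h =>
    (hF.continuous_field.comp_stronglyMeasurable (hu.prodMk (hstep h))).add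
      ((hF.continuous_weight.comp_stronglyMeasurable hu).smul
        (stronglyMeasurable_comp_eulerStep γ))
  set B := Real.exp (Λ * T) * (1 + ‖x₀‖) with hB
  set D := Λ * B with hD
  have hD0 : 0 ≤ D := by positivity
  have hFb : ∀ h, 0 < h → ∀ t ∈ Icc 0 T, ‖V (eulerStep V x₀ h t) t‖ ≤ D := fun h hh t ht =>
    norm_apply_eulerStep_le hh hΛ hV ht.1 ht.2
  have hSb : ∀ h, 0 < h → ∀ t ∈ Icc 0 T, ‖eulerStep V x₀ h t‖ ≤ B := fun h hh t ht => by
    have := norm_eulerStep_le (x₀ := x₀) hh hΛ hV ht.1 ht.2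
    linarith
  have hnear : ∀ h, 0 < h → ∀ t ∈ Icc 0 T,
      ‖eulerCurve V x₀ h t - eulerStep V x₀ h t‖ ≤ D * h := fun h hh t ht =>
    norm_eulerCurve_sub_eulerStep_le hh hΛ hV (hm h) ht
  have hAC : ∀ h, 0 < h → AbsolutelyContinuousOnInterval (eulerCurve V x₀ h) 0 T := fun h hh =>
    eulerCurve_absolutelyContinuousOnInterval hT hh hΛ hV (hm h)
  have hzero : ∀ h, eulerCurve V x₀ h 0 = x₀ := fun h => by simp [eulerCurve]
  -- Monotonicity holds at the Euler nodes, while the curves differ from them by at most `D * h` and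
  -- `D * h'`. The error rate is thus `2 * (2 * D) * (D * (h + h'))`.
  have hcauchy : ∀ h h', 0 < h → 0 < h' → ∀ t ∈ Icc 0 T,
      ‖eulerCurve V x₀ h t - eulerCurve V x₀ h' t‖ ^ 2 ≤ 4 * D ^ 2 * T * (h + h') := by
    intro h h' hh hh' t ht
    have key := norm_sq_sub_le_integral
      (x := fun τ => eulerCurve V x₀ h τ - eulerCurve V x₀ h' τ)
      (ρ := fun _ => 4 * D ^ 2 * (h + h')) ((hAC h hh).fun_sub (hAC h' hh'))
      (integrable_const _) (by
        filter_upwards [eulerCurve_ae_hasDerivAt hT hh hΛ hV (hm h),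
          eulerCurve_ae_hasDerivAt hT hh' hΛ hV (hm h'),
          ae_restrict_mem measurableSet_Icc] with τ h1 h2 h3
        refine ⟨_, h1.sub h2, ?_⟩
        set X := eulerStep V x₀ h τ with hX
        set X' := eulerStep V x₀ h' τ with hX'
        set r := (eulerCurve V x₀ h τ - X) - (eulerCurve V x₀ h' τ - X') with hr
        have e : eulerCurve V x₀ h τ - eulerCurve V x₀ h' τ = (X - X') + r := by
          rw [hr]; abel
        have hrn : ‖r‖ ≤ D * (h + h') := by
          refine (norm_sub_le _ _).trans ?_
          have := hnear h hh τ h3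
          have := hnear h' hh' τ h3
          linarith
        have hVn : ‖V X τ - V X' τ‖ ≤ 2 * D := by
          refine (norm_sub_le _ _).trans ?_
          have := hFb h hh τ h3
          have := hFb h' hh' τ h3
          linarith
        have hmon : 0 ≤ inner ℝ (V X τ - V X' τ) (X - X') := by
          have e2 : V X τ - V X' τ = (Φ (u τ) X - Φ (u τ) X') + c (u τ) • (γ X - γ X') := by
            simp only [hVdef]; module
          rw [e2, inner_add_left, real_inner_smul_left]
          exact add_nonneg (hF.monotone _ (huS τ) X X') (mul_nonneg (hF.weight_nonneg _ (huS τ))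
            (subdifferential_monotone (hγ X) (hγ X')))
        have hin := (abs_le.1 (abs_real_inner_le_norm (V X τ - V X' τ) r)).1
        have hpr : ‖V X τ - V X' τ‖ * ‖r‖ ≤ 2 * D * (D * (h + h')) :=
          mul_le_mul hVn hrn (norm_nonneg _) (by positivity)
        have e3 : -V X τ - -V X' τ = -(V X τ - V X' τ) := by abel
        rw [e, e3, inner_neg_right, real_inner_comm, inner_add_right]
        linarith)
      le_rfl ht.1 ht.2
    simp only [hzero, sub_self, norm_zero, intervalIntegral.integral_const, sub_zero,
      smul_eq_mul] at key
    have : t * (4 * D ^ 2 * (h + h')) ≤ T * (4 * D ^ 2 * (h + h')) :=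
      mul_le_mul_of_nonneg_right ht.2 (by positivity)
    linarith
  -- The subgradient inequality at the node replaces the selection `γ` by values of `R`; moving from
  -- node to curve costs `2 * D * (D * h)`.
  have hevi : ∀ h, 0 < h → ∀ z, ∀ s t, 0 ≤ s → s ≤ t → t ≤ T →
      ‖eulerCurve V x₀ h t - z‖ ^ 2 - ‖eulerCurve V x₀ h s - z‖ ^ 2 ≤
        ∫ τ in s..t, (variationalRate Φ c R u z (eulerStep V x₀ h) τ + 2 * D ^ 2 * h) := by
    intro h hh z s t hs hst ht
    refine norm_sq_sub_le_integral (x := fun τ => eulerCurve V x₀ h τ - z)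
      ((hAC h hh).fun_sub (absolutelyContinuousOnInterval_const z 0 T))
      ((integrableOn_variationalRate hF hRc hu huS z (hstep h).aestronglyMeasurable
        (hSb h hh)).add (integrable_const _)) ?_ hs hst ht
    filter_upwards [eulerCurve_ae_hasDerivAt hT hh hΛ hV (hm h),
      ae_restrict_mem measurableSet_Icc] with τ h1 h3
    refine ⟨_, h1.sub_const z, ?_⟩
    set X := eulerStep V x₀ h τ with hX
    set r := eulerCurve V x₀ h τ - X with hr
    have e : eulerCurve V x₀ h τ - z = (X - z) + r := by rw [hr]; abel
    have hg := hγ X z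
    have hc := mul_le_mul_of_nonneg_left hg (hF.weight_nonneg _ (huS τ))
    have hin := (abs_le.1 (abs_real_inner_le_norm (V X τ) r)).1
    have hpr : ‖V X τ‖ * ‖r‖ ≤ D * (D * h) :=
      mul_le_mul (hFb h hh τ h3) (hnear h hh τ h3) (norm_nonneg _) hD0
    have e4 : inner ℝ (V X τ) (X - z) =
        inner ℝ (Φ (u τ) X) (X - z) - c (u τ) * inner ℝ (γ X) (z - X) := by
      rw [hVdef, inner_add_left, real_inner_smul_left, ← neg_sub z X, inner_neg_right,
        inner_neg_right]
      ring
    rw [e, inner_neg_right, real_inner_comm, inner_add_right, e4, variationalRate, ← hX]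
    linarith
  set ηs : ℕ → ℝ := fun k => 1 / ((k : ℝ) + 1) with hηs
  have hη0 : ∀ k, 0 < ηs k := fun k => Nat.one_div_pos_of_nat
  have hηlim : Tendsto ηs atTop (𝓝 0) := tendsto_one_div_add_atTop_nhds_zero_nat
  have hlim : ∀ t, ∃ y, t ∈ Icc 0 T → Tendsto (fun k => eulerCurve V x₀ (ηs k) t) atTop (𝓝 y) := by
    intro t
    by_cases ht : t ∈ Icc 0 T
    · have : CauchySeq (fun k => eulerCurve V x₀ (ηs k) t) := by
        refine cauchySeq_of_le_tendsto_0 (fun k => √(4 * D ^ 2 * T * (ηs k + ηs k))) ?_ ?_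
        · intro i j N hi hj
          rw [dist_eq_norm]
          refine Real.le_sqrt_of_sq_le ((hcauchy _ _ (hη0 i) (hη0 j) t ht).trans ?_)
          have h1 : ηs i ≤ ηs N := Nat.one_div_le_one_div hi
          have h2 : ηs j ≤ ηs N := Nat.one_div_le_one_div hj
          gcongr
        · have := ((hηlim.add hηlim).const_mul (4 * D ^ 2 * T)).sqrt
          simpa using this
      obtain ⟨y, hy⟩ := cauchySeq_tendsto_of_complete this
      exact ⟨y, fun _ => hy⟩
    · exact ⟨0, fun h => absurd h ht⟩
  choose x hx using hlim
  have hxstep : ∀ t ∈ Icc 0 T, Tendsto (fun k => eulerStep V x₀ (ηs k) t) atTop (𝓝 (x t)) := by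
    intro t ht
    have h1 : Tendsto (fun k => eulerCurve V x₀ (ηs k) t - eulerStep V x₀ (ηs k) t) atTop
        (𝓝 0) := by
      refine squeeze_zero_norm (fun k => hnear _ (hη0 k) t ht) ?_
      simpa using hηlim.const_mul D
    simpa using (hx t ht).sub h1
  refine ⟨x, isSol_of_variational (K := D.toNNReal) hF hT hR hu huS ?_ ?_ ?_⟩
  · refine LipschitzOnWith.of_dist_le_mul fun s hs t ht => ?_
    refine le_of_tendsto ((hx s hs).dist (hx t ht)) (Eventually.of_forall fun k => ?_)
    exact (eulerCurve_lipschitzOnWith (T := T) (hη0 k) hΛ hV (hm _)).dist_le_mul _ hs _ ht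
  · have := hx 0 ⟨le_rfl, hT⟩
    simp only [hzero] at this
    exact tendsto_nhds_unique this tendsto_const_nhds
  · intro z s t hs hst ht
    have hsm : s ∈ Icc 0 T := ⟨hs, hst.trans ht⟩
    have htm : t ∈ Icc 0 T := ⟨hs.trans hst, ht⟩
    obtain ⟨K, hK⟩ := exists_bound_variationalRate (z := z) hF hRc B
    -- No trace of `γ` remains in the inequality, so continuity of `R` and `Φ` suffices to pass to
    -- the limit.
    refine le_of_tendsto_of_tendsto
      ((((hx t htm).sub_const z).norm.pow 2).sub (((hx s hsm).sub_const z).norm.pow 2)) ?_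
      (Eventually.of_forall fun k => hevi _ (hη0 k) z s t hs hst ht)
    refine intervalIntegral.tendsto_integral_filter_of_dominated_convergence
      (fun _ => K + 2 * D ^ 2 * 1) (Eventually.of_forall fun k => ?_)
      (Eventually.of_forall fun k => Eventually.of_forall fun τ hτ => ?_)
      intervalIntegrable_const (Eventually.of_forall fun τ hτ => ?_)
    · exact (aestronglyMeasurable_variationalRate hF hRc hu z
        (hstep _).aestronglyMeasurable).add aestronglyMeasurable_const
    · have hτ' := uIcc_subset_Icc hsm htm (uIoc_subset_uIcc hτ)
      refine (norm_add_le _ _).trans (add_le_add (hK u _ τ (huS τ) (hSb _ (hη0 k) τ hτ')) ?_)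
      rw [Real.norm_of_nonneg (mul_nonneg (by positivity) (hη0 k).le)]
      have : ηs k ≤ 1 := by
        have := Nat.one_div_le_one_div (α := ℝ) (Nat.zero_le k)
        simpa [hηs] using this
      gcongr
    · have hτ' := uIcc_subset_Icc hsm htm (uIoc_subset_uIcc hτ)
      have h1 := hxstep τ hτ'
      have h2 : Tendsto (fun k => Φ (u τ) (eulerStep V x₀ (ηs k) τ)) atTop (𝓝 (Φ (u τ) (x τ))) :=
        (hF.continuous_field.tendsto (u τ, x τ)).comp (tendsto_const_nhds.prodMk_nhds h1)
      have h3 := (hRc.tendsto (x τ)).comp h1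
      have h4 := (((h3.const_sub (R z)).const_mul (c (u τ))).sub
        (h2.inner (h1.sub_const z))).const_mul 2
      simpa [variationalRate] using h4.add (hηlim.const_mul (2 * D ^ 2))

/-- The Euler scheme wants control values in `S` at every time. Overwriting the control by `s₀` on a
measurable null set achieves this without changing the solutions. -/
theorem exists_isSol (hF : FieldBound Φ c S L) (hS : S.Nonempty) (hT : 0 ≤ T)
    (hR : ConvexOn ℝ univ R) (hM : 0 ≤ M)
    (hsub : ∀ x, ∀ g ∈ subdifferential R x, ‖g‖ ≤ M * (1 + ‖x‖))
    (hu : StronglyMeasurable u) (huS : ∀ᵐ t ∂timeMeasure T, u t ∈ S) :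
    ∃ x, IsSol T R Φ c x₀ u x := by
  classical
  obtain ⟨s₀, hs₀⟩ := hS
  set N := toMeasurable (timeMeasure T) {t | u t ∉ S} with hN
  have hN0 : timeMeasure T N = 0 := by rw [hN, measure_toMeasurable]; exact huS
  have hNS : ∀ t, t ∉ N → u t ∈ S := fun t ht => by
    by_contra h
    exact ht (subset_toMeasurable _ _ h)
  obtain ⟨x, hx⟩ := exists_isSol_of_forall_mem (u := N.piecewise (fun _ => s₀) u) (x₀ := x₀)
    hF hT hR hM hsub
    (stronglyMeasurable_const.piecewise (measurableSet_toMeasurable _ _) hu) (fun t => by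
      by_cases ht : t ∈ N
      · simpa [ht] using hs₀
      · simpa [ht] using hNS t ht)
  refine ⟨x, hx.congr_control ?_⟩
  have : ∀ᵐ t ∂timeMeasure T, t ∉ N := measure_eq_zero_iff_ae_notMem.1 hN0
  filter_upwards [this] with t ht
  simp [ht]

end

/-! ### Compactness of bounded, shift-equicontinuous sequences -/

theorem exists_subseq_tendsto_of_lipschitzWith {X F : Type*} [PseudoMetricSpace X] [CompactSpace X]
    [NormedAddCommGroup F] [ProperSpace F] (f : ℕ → BoundedContinuousFunction X F) {K : NNReal}
    {B : ℝ} (hK : ∀ k, LipschitzWith K (f k)) (hB : ∀ k x, ‖f k x‖ ≤ B) :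
    ∃ g, ∃ φ : ℕ → ℕ, StrictMono φ ∧ Tendsto (f ∘ φ) atTop (𝓝 g) := by
  have hcomp : IsCompact (closure (range f)) := by
    refine BoundedContinuousFunction.arzela_ascoli (Metric.closedBall 0 B)
      (isCompact_closedBall 0 B) (range f) ?_ ?_
    · rintro _ x ⟨k, rfl⟩
      simpa using hB k x
    · refine (LipschitzWith.uniformEquicontinuous _ K ?_).equicontinuous
      rintro ⟨_, k, rfl⟩
      exact hK k
  obtain ⟨g, -, φ, hφ, hlim⟩ := hcomp.tendsto_subseq (fun k => subset_closure (mem_range_self k))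
  exact ⟨g, φ, hφ, hlim⟩

theorem intervalIntegrable_of_ae_bound {F : Type*} [NormedAddCommGroup F] {u : ℝ → F}
    {K : ℝ} (hm : StronglyMeasurable u)
    (hK : ∀ᵐ t, ‖u t‖ ≤ K) (a b : ℝ) : IntervalIntegrable u volume a b := by
  refine ((intervalIntegrable_const (c := K)).mono_fun hm.aestronglyMeasurable.restrict ?_)
  filter_upwards [ae_restrict_of_ae hK] with t ht
  exact ht.trans (le_abs_self K)

/-- Bounded a.e. convergence implies convergence in `L^p`. -/
theorem tendsto_eLpNorm_of_ae_bound {F : Type*} [NormedAddCommGroup F] {μ : Measure ℝ} [IsFiniteMeasure μ] {p : ℝ≥0∞}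
    (hp1 : 1 ≤ p)
    (hp : p ≠ ∞) {u : ℕ → ℝ → F} {w : ℝ → F} {K : ℝ} (hm : ∀ k, StronglyMeasurable (u k))
    (hw : StronglyMeasurable w) (hK : ∀ k, ∀ᵐ t ∂μ, ‖u k t‖ ≤ K) (hKw : ∀ᵐ t ∂μ, ‖w t‖ ≤ K)
    (hlim : ∀ᵐ t ∂μ, Tendsto (fun k => u k t) atTop (𝓝 (w t))) :
    Tendsto (fun k => eLpNorm (u k - w) p μ) atTop (𝓝 0) := by
  refine tendsto_Lp_finite_of_tendsto_ae hp1 hp (fun k => (hm k).aestronglyMeasurable)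
    (MemLp.of_bound hw.aestronglyMeasurable K hKw) ?_ hlim
  -- Above the level `K + 1` the truncated functions vanish a.e., which gives uniform integrability.
  refine unifIntegrable_of hp1 hp (fun k => (hm k).aestronglyMeasurable) fun ε hε =>
    ⟨K.toNNReal + 1, fun k => ?_⟩
  have : {x | K.toNNReal + 1 ≤ ‖u k x‖₊}.indicator (u k) =ᵐ[μ] 0 := by
    filter_upwards [hK k] with t ht
    refine indicator_of_notMem (fun hmem => ?_) _
    have h1 : ((K.toNNReal + 1 : NNReal) : ℝ) ≤ ‖u k t‖ := hmem
    have h2 := Real.le_coe_toNNReal K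
    push_cast at h1
    linarith
  rw [eLpNorm_congr_ae this, eLpNorm_zero]
  exact zero_le

section

variable {F : Type*} [NormedAddCommGroup F] [NormedSpace ℝ F]

theorem lipschitzWith_integral_of_ae_bound {u : ℝ → F} {K : NNReal} (hm : StronglyMeasurable u)
    (hK : ∀ᵐ t, ‖u t‖ ≤ K) : LipschitzWith K (fun t => ∫ s in (0 : ℝ)..t, u s) := by
  refine LipschitzWith.of_dist_le_mul fun s t => ?_
  rw [dist_eq_norm, Real.dist_eq, intervalIntegral.integral_interval_sub_left
    (intervalIntegrable_of_ae_bound hm hK _ _) (intervalIntegrable_of_ae_bound hm hK _ _)]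
  exact intervalIntegral.norm_integral_le_of_norm_le_const_ae (hK.mono fun t ht _ => ht)

/-- The difference quotient of the primitive minus `u` is the average over `s ∈ (0, h]` of `u (t +
s) - u t`; Tonelli then brings in the shift estimate for each `s`. -/
theorem lintegral_enorm_average_sub_le [CompleteSpace F] {u : ℝ → F} {K T h : ℝ} {ε : ℝ≥0∞} (hh : 0 < h)
    (hm : StronglyMeasurable u) (hK : ∀ᵐ t, ‖u t‖ ≤ K)
    (hshift : ∀ s ∈ Ioc 0 h, ∫⁻ t in Icc 0 T, ‖u (t + s) - u t‖ₑ ≤ ε) :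
    ∫⁻ t in Icc 0 T, ‖h⁻¹ • ((∫ s in (0 : ℝ)..(t + h), u s) - ∫ s in (0 : ℝ)..t, u s) - u t‖ₑ
      ≤ ε := by
  have hint := intervalIntegrable_of_ae_bound hm hK
  have e1 : ∀ t, h⁻¹ • ((∫ s in (0 : ℝ)..(t + h), u s) - ∫ s in (0 : ℝ)..t, u s) - u t
      = h⁻¹ • ∫ s in Ioc 0 h, (u (t + s) - u t) := by
    intro t
    have h1 : IntervalIntegrable (fun s => u (t + s)) volume 0 h := by
      simpa [add_comm] using (hint t (t + h)).comp_add_right t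
    rw [← intervalIntegral.integral_of_le hh.le, intervalIntegral.integral_sub h1
      intervalIntegrable_const, intervalIntegral.integral_comp_add_left, add_zero,
      intervalIntegral.integral_interval_sub_left (hint _ _) (hint _ _),
      intervalIntegral.integral_const, sub_zero, smul_sub, inv_smul_smul₀ hh.ne']
  have hmeas : StronglyMeasurable (fun q : ℝ × ℝ => u (q.1 + q.2) - u q.1) :=
    (hm.comp_measurable (measurable_fst.add measurable_snd)).sub (hm.comp_measurable measurable_fst)
  calc ∫⁻ t in Icc 0 T, ‖h⁻¹ • ((∫ s in (0 : ℝ)..(t + h), u s) - ∫ s in (0 : ℝ)..t, u s) - u t‖ₑ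
      ≤ ∫⁻ t in Icc 0 T, ‖h⁻¹‖ₑ * ∫⁻ s in Ioc 0 h, ‖u (t + s) - u t‖ₑ := by
        refine lintegral_mono fun t => ?_
        rw [e1, enorm_smul]
        gcongr
        exact enorm_integral_le_lintegral_enorm _
    _ = ‖h⁻¹‖ₑ * ∫⁻ t in Icc 0 T, ∫⁻ s in Ioc 0 h, ‖u (t + s) - u t‖ₑ :=
        lintegral_const_mul' _ _ (by simp)
    _ = ‖h⁻¹‖ₑ * ∫⁻ s in Ioc 0 h, ∫⁻ t in Icc 0 T, ‖u (t + s) - u t‖ₑ := by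
        rw [lintegral_lintegral_swap hmeas.enorm.aemeasurable]
    _ ≤ ‖h⁻¹‖ₑ * ∫⁻ s in Ioc 0 h, ε := by
        refine mul_le_mul_right ?_ _
        exact setLIntegral_mono' measurableSet_Ioc hshift
    _ = ε := by
        rw [setLIntegral_const, Real.volume_Ioc, sub_zero, mul_left_comm,
          Real.enorm_of_nonneg (inv_nonneg.2 hh.le), ← ENNReal.ofReal_mul (inv_nonneg.2 hh.le),
          inv_mul_cancel₀ hh.ne', ENNReal.ofReal_one, mul_one]

/-- A sequence that is bounded in `L^∞` and equicontinuous under shifts in `L¹` has a subsequence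
converging a.e. -/
theorem exists_subseq_tendsto_ae [FiniteDimensional ℝ F] {T : ℝ} {K : NNReal} (hT : 0 ≤ T)
    (u : ℕ → ℝ → F) (hm : ∀ k, StronglyMeasurable (u k)) (hK : ∀ k, ∀ᵐ t, ‖u k t‖ ≤ K)
    (hshift : ∀ ε : ℝ, 0 < ε → ∃ δ : ℝ, 0 < δ ∧ ∀ h : ℝ, |h| < δ → ∀ k,
      ∫⁻ t in Icc 0 T, ‖u k (t + h) - u k t‖ₑ ≤ ENNReal.ofReal ε) :
    ∃ φ : ℕ → ℕ, StrictMono φ ∧ ∃ w, StronglyMeasurable w ∧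
      ∀ᵐ t ∂timeMeasure T, Tendsto (fun k => u (φ k) t) atTop (𝓝 (w t)) := by
  have hproper : ProperSpace F := FiniteDimensional.proper_real F
  have hcomplete : CompleteSpace F := FiniteDimensional.complete ℝ F
  set U : ℕ → ℝ → F := fun k t => ∫ s in (0 : ℝ)..t, u k s with hU
  have hUL : ∀ k, LipschitzWith K (U k) := fun k => lipschitzWith_integral_of_ae_bound (hm k) (hK k)
  -- The interval has length `T + 1` so that it contains `t + h` for `t ≤ T` and `h ≤ 1`.
  set f : ℕ → BoundedContinuousFunction (Icc (0 : ℝ) (T + 1)) F := fun k =>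
    BoundedContinuousFunction.mkOfCompact ⟨fun t => U k t, (hUL k).continuous.comp continuous_subtype_val⟩
    with hf
  obtain ⟨g, φ, hφ, hlim⟩ := exists_subseq_tendsto_of_lipschitzWith f (K := K)
    (B := K * (T + 1)) (fun k =>
      LipschitzWith.of_dist_le_mul fun s t => (hUL k).dist_le_mul s t) (fun k t => by
      have := (hUL k).dist_le_mul t.1 0
      simp only [hU, intervalIntegral.integral_same, dist_zero_right, Real.norm_eq_abs,
        abs_of_nonneg t.2.1] at this
      exact this.trans (mul_le_mul_of_nonneg_left t.2.2 K.2))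
  have hmem : ∀ k, MemLp (u k) 1 (timeMeasure T) := fun k =>
    MemLp.of_bound (hm k).aestronglyMeasurable K (ae_restrict_of_ae (hK k))
  have hcauchy : CauchySeq (fun k => (hmem (φ k)).toLp) := by
    rw [EMetric.cauchySeq_iff]
    intro ε hε
    obtain ⟨ε', hε'0, hε'⟩ : ∃ ε' : ℝ, 0 < ε' ∧ 3 * ENNReal.ofReal ε' < ε := by
      obtain ⟨r, -, hr0, hr⟩ := ENNReal.lt_iff_exists_real_btwn.1 hε
      refine ⟨r / 3, div_pos (ENNReal.ofReal_pos.1 hr0) three_pos, ?_⟩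
      rwa [← ENNReal.ofReal_ofNat, ← ENNReal.ofReal_mul zero_le_three,
        mul_div_cancel₀ _ three_ne_zero]
    obtain ⟨δ, hδ, hsh⟩ := hshift ε' hε'0
    set h := min (δ / 2) 1 with hh
    have hh0 : 0 < h := by positivity
    have hh1 : h ≤ 1 := min_le_right _ _
    have havg : ∀ k, ∫⁻ t in Icc 0 T, ‖h⁻¹ • (U k (t + h) - U k t) - u k t‖ₑ
        ≤ ENNReal.ofReal ε' := fun k =>
      lintegral_enorm_average_sub_le hh0 (hm k) (hK k) fun s hs => hsh s (by
        rw [abs_of_pos hs.1]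
        have : h ≤ δ / 2 := min_le_left _ _
        linarith [hs.2]) k
    -- Two values of the primitives enter and are divided by `h`, leaving `ε' / (T + 1)` pointwise,
    -- hence at most `ε'` after integration over `[0, T]`.
    obtain ⟨N, hN⟩ := Metric.cauchySeq_iff.1 hlim.cauchySeq (h * ε' / (2 * (T + 1)))
      (by positivity)
    refine ⟨N, fun k hk l hl => ?_⟩
    rw [Lp.edist_toLp_toLp, eLpNorm_one_eq_lintegral_enorm]
    refine lt_of_le_of_lt ?_ hε'
    have hUd : ∀ t ∈ Icc 0 (T + 1), ‖U (φ k) t - U (φ l) t‖ ≤ h * ε' / (2 * (T + 1)) := by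
      intro t ht
      rw [← dist_eq_norm]
      exact ((BoundedContinuousFunction.dist_coe_le_dist (f := f (φ k)) (g := f (φ l))
        ⟨t, ht⟩)).trans (hN k hk l hl).le
    have hmid : ∫⁻ t in Icc 0 T, ‖h⁻¹ • (U (φ k) (t + h) - U (φ k) t)
        - h⁻¹ • (U (φ l) (t + h) - U (φ l) t)‖ₑ ≤ ENNReal.ofReal ε' := by
      calc _ ≤ ∫⁻ t in Icc 0 T, ENNReal.ofReal (ε' / (T + 1)) := by
            refine setLIntegral_mono' measurableSet_Icc fun t ht => ?_
            rw [← ofReal_norm]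
            refine ENNReal.ofReal_le_ofReal ?_
            have h1 := hUd t ⟨ht.1, by linarith [ht.2]⟩
            have h2 := hUd (t + h) ⟨by linarith [ht.1], by linarith [ht.2]⟩
            have e : h⁻¹ • (U (φ k) (t + h) - U (φ k) t) - h⁻¹ • (U (φ l) (t + h) - U (φ l) t)
              = h⁻¹ • ((U (φ k) (t + h) - U (φ l) (t + h)) - (U (φ k) t - U (φ l) t)) := by
              module
            rw [e, norm_smul, Real.norm_of_nonneg (by positivity), inv_mul_le_iff₀ hh0]
            refine (norm_sub_le _ _).trans ((add_le_add h2 h1).trans_eq ?_)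
            field_simp
            ring
        _ = ENNReal.ofReal (ε' / (T + 1) * T) := by
            rw [setLIntegral_const, Real.volume_Icc, sub_zero, ENNReal.ofReal_mul (by positivity)]
        _ ≤ ENNReal.ofReal ε' := by
            refine ENNReal.ofReal_le_ofReal ?_
            rw [div_mul_eq_mul_div, div_le_iff₀ (by linarith)]
            nlinarith
    have hmU : ∀ k, StronglyMeasurable fun t => h⁻¹ • (U k (t + h) - U k t) := fun k => by
      have := (hUL k).continuous
      exact (by fun_prop : Continuous fun t => h⁻¹ • (U k (t + h) - U k t)).stronglyMeasurable
    calc ∫⁻ t in Icc 0 T, ‖(u (φ k) - u (φ l)) t‖ₑ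
        ≤ ∫⁻ t in Icc 0 T, (‖h⁻¹ • (U (φ k) (t + h) - U (φ k) t) - u (φ k) t‖ₑ
            + ‖h⁻¹ • (U (φ k) (t + h) - U (φ k) t) - h⁻¹ • (U (φ l) (t + h) - U (φ l) t)‖ₑ
            + ‖h⁻¹ • (U (φ l) (t + h) - U (φ l) t) - u (φ l) t‖ₑ) := by
          refine lintegral_mono fun t => ?_
          rw [Pi.sub_apply, ← edist_eq_enorm_sub, ← edist_eq_enorm_sub, ← edist_eq_enorm_sub,
            ← edist_eq_enorm_sub, edist_comm _ (u (φ k) t)]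
          exact edist_triangle4 _ _ _ _
      _ ≤ ENNReal.ofReal ε' + ENNReal.ofReal ε' + ENNReal.ofReal ε' := by
          have m1 : Measurable fun t => ‖h⁻¹ • (U (φ k) (t + h) - U (φ k) t) - u (φ k) t‖ₑ :=
            ((hmU _).sub (hm _)).enorm
          have m2 : Measurable fun t => ‖h⁻¹ • (U (φ k) (t + h) - U (φ k) t)
              - h⁻¹ • (U (φ l) (t + h) - U (φ l) t)‖ₑ := ((hmU _).sub (hmU _)).enorm
          have m3 : Measurable fun t => ‖h⁻¹ • (U (φ k) (t + h) - U (φ k) t) - u (φ k) t‖ₑ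
              + ‖h⁻¹ • (U (φ k) (t + h) - U (φ k) t)
                - h⁻¹ • (U (φ l) (t + h) - U (φ l) t)‖ₑ := m1.add m2
          rw [lintegral_add_left m3, lintegral_add_left m1]
          exact add_le_add (add_le_add (havg _) hmid) (havg _)
      _ = 3 * ENNReal.ofReal ε' := by ring
  obtain ⟨w, hw⟩ := cauchySeq_tendsto_of_complete hcauchy
  obtain ⟨ψ, hψ, hae⟩ := (tendstoInMeasure_of_tendsto_Lp hw).exists_seq_tendsto_ae
  refine ⟨φ ∘ ψ, hφ.comp hψ, w, Lp.stronglyMeasurable w, ?_⟩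
  filter_upwards [hae, ae_all_iff.2 fun k => (hmem (φ k)).coeFn_toLp] with t h1 h2
  simpa [h2] using h1

end

/-! ### The control system of the network -/

section

variable {m n : ℕ}

theorem ControlSpace.continuous_A : Continuous (ControlSpace.A : ControlSpace m n → _) :=
  (WithLp.prod_continuous_ofLp 1 _ _).fst

theorem ControlSpace.continuous_α : Continuous (ControlSpace.α : ControlSpace m n → ℝ) :=
  ((WithLp.prod_continuous_ofLp 1 _ _).comp (WithLp.prod_continuous_ofLp 1 _ _).snd).fst

theorem ControlSpace.continuous_lam : Continuous (ControlSpace.lam : ControlSpace m n → ℝ) :=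
  ((WithLp.prod_continuous_ofLp 1 _ _).comp (WithLp.prod_continuous_ofLp 1 _ _).snd).snd

theorem ControlSpace.norm_A_le (s : ControlSpace m n) : ‖s.A‖ ≤ ‖s‖ := by
  rw [norm_controlSpace]
  linarith [abs_nonneg s.α, abs_nonneg s.lam]

theorem ControlSpace.abs_α_le (s : ControlSpace m n) : |s.α| ≤ ‖s‖ := by
  rw [norm_controlSpace]
  linarith [norm_nonneg s.A, abs_nonneg s.lam]

theorem ControlSpace.abs_lam_le (s : ControlSpace m n) : |s.lam| ≤ ‖s‖ := by
  rw [norm_controlSpace]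
  linarith [norm_nonneg s.A, abs_nonneg s.α]

/-- The smooth part `η Uᵀ (U x - b)` of the state inclusion. -/
noncomputable def controlField (b : Euc m) (s : ControlSpace m n) (x : Euc n) : Euc n :=
  s.α • fidelityGrad s.A b x

/-- The weight `η ζ` of the subdifferential in the state inclusion. -/
noncomputable def controlWeight (s : ControlSpace m n) : ℝ := s.α * s.lam

/-- The control values with nonnegative scalar components and norm at most `K`. -/
def admissibleControls (m n : ℕ) (K : ℝ) : Set (ControlSpace m n) :=
  {s | 0 ≤ s.α ∧ 0 ≤ s.lam ∧ ‖s‖ ≤ K}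

theorem continuous_controlField (b : Euc m) :
    Continuous (Function.uncurry (controlField (n := n) b)) := by
  have hA : Continuous fun q : ControlSpace m n × Euc n => q.1.A :=
    ControlSpace.continuous_A.comp continuous_fst
  have hα : Continuous fun q : ControlSpace m n × Euc n => q.1.α :=
    ControlSpace.continuous_α.comp continuous_fst
  have hx : Continuous fun q : ControlSpace m n × Euc n => q.2.ofLp :=
    (PiLp.continuous_ofLp 2 _).comp continuous_snd
  exact hα.smul ((PiLp.continuous_toLp 2 _).comp
    (hA.matrix_transpose.matrix_mulVec ((hA.matrix_mulVec hx).sub continuous_const)))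

theorem norm_fidelityGrad_le (U : Matrix (Fin m) (Fin n) ℝ) (b : Euc m) (x : Euc n) :
    ‖fidelityGrad U b x‖ ≤ ‖U‖ * (‖U‖ * ‖x‖ + ‖b‖) := by
  have h1 := Matrix.l2_opNorm_mulVec Uᵀ (WithLp.toLp 2 (U *ᵥ x.ofLp - b.ofLp))
  have h2 : ‖Uᵀ‖ = ‖U‖ := by
    rw [← Matrix.conjTranspose_eq_transpose_of_trivial, Matrix.l2_opNorm_conjTranspose]
  rw [h2] at h1
  refine h1.trans (mul_le_mul_of_nonneg_left ?_ (norm_nonneg _))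
  rw [WithLp.toLp_sub]
  exact (norm_sub_le _ _).trans (add_le_add_left (Matrix.l2_opNorm_mulVec U x) _)

/-- The inner product equals `‖U (x - z)‖²`. -/
theorem fidelityGrad_monotone (U : Matrix (Fin m) (Fin n) ℝ) (b : Euc m) (x z : Euc n) :
    0 ≤ inner ℝ (fidelityGrad U b x - fidelityGrad U b z) (x - z) := by
  have e : fidelityGrad U b x - fidelityGrad U b z =
      WithLp.toLp 2 (Uᵀ *ᵥ (U *ᵥ (x - z).ofLp)) := by
    rw [fidelityGrad, fidelityGrad, ← WithLp.toLp_sub, ← Matrix.mulVec_sub, WithLp.ofLp_sub,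
      Matrix.mulVec_sub U, sub_sub_sub_cancel_right]
  rw [e, EuclideanSpace.inner_eq_star_dotProduct, star_trivial, Matrix.dotProduct_mulVec,
    Matrix.vecMul_transpose]
  exact Finset.sum_nonneg fun i _ => mul_self_nonneg _

/-- In the constant, the first term bounds the growth of the field, `K * K` bounds the weight, and
`1` secures positivity. -/
theorem fieldBound_control (b : Euc m) {K : ℝ} (hK : 0 ≤ K) :
    FieldBound (controlField (n := n) b) controlWeight (admissibleControls m n K)
      (K * (K * (K + ‖b‖)) + K * K + 1) where
  pos := by positivity
  continuous_field := continuous_controlField b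
  continuous_weight := ControlSpace.continuous_α.mul ControlSpace.continuous_lam
  weight_nonneg s hs := mul_nonneg hs.1 hs.2.1
  weight_le s hs := by
    have h1 : s.α ≤ K := (le_abs_self _).trans (s.abs_α_le.trans hs.2.2)
    have h2 : s.lam ≤ K := (le_abs_self _).trans (s.abs_lam_le.trans hs.2.2)
    have h3 : controlWeight s ≤ K * K := mul_le_mul h1 h2 hs.2.1 hK
    have h4 : 0 ≤ K * (K * (K + ‖b‖)) := by positivity
    linarith
  norm_le s hs x := by
    have h1 : |s.α| ≤ K := s.abs_α_le.trans hs.2.2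
    have h2 : ‖s.A‖ ≤ K := s.norm_A_le.trans hs.2.2
    rw [controlField, norm_smul, Real.norm_eq_abs]
    calc |s.α| * ‖fidelityGrad s.A b x‖ ≤ K * (K * (K * ‖x‖ + ‖b‖)) := by
          refine mul_le_mul h1 ((norm_fidelityGrad_le _ _ _).trans ?_) (norm_nonneg _) hK
          gcongr
      _ ≤ K * (K * ((K + ‖b‖) * (1 + ‖x‖))) := by
          gcongr
          nlinarith [mul_nonneg (norm_nonneg b) (norm_nonneg x)]
      _ = K * (K * (K + ‖b‖)) * (1 + ‖x‖) := by ring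
      _ ≤ _ := by
          gcongr
          nlinarith [mul_nonneg hK hK]
  monotone s hs x z := by
    rw [controlField, controlField, ← smul_sub, real_inner_smul_left]
    exact mul_nonneg hs.1 (fidelityGrad_monotone _ _ _ _)

theorem isState_iff_isSol {T : ℝ} {R : Euc n → ℝ} {b : Euc m} {x₀ : Euc n}
    {u : ℝ → ControlSpace m n} {x : ℝ → Euc n} :
    IsState T R b x₀ u x ↔ IsSol T R (controlField b) controlWeight x₀ u x :=
  Iff.rfl

theorem norm_subgradient_le {R : Euc n → ℝ} {M : ℝ} (hM : 0 < M)
    (h : ∀ x : Euc n, (∀ z ∈ subdifferential R x, ‖z‖ ≤ M * ‖x‖) ∨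
      (∀ z ∈ subdifferential R x, ‖z‖ ≤ M)) (x : Euc n) :
    ∀ g ∈ subdifferential R x, ‖g‖ ≤ M * (1 + ‖x‖) := by
  intro g hg
  have : 0 ≤ M * ‖x‖ := by positivity
  rcases h x with h | h <;> linarith [h g hg]

theorem ae_mem_admissibleControls {T K : ℝ} {u : Lp (ControlSpace m n) ∞ (timeMeasure T)}
    (hnonneg : ∀ᵐ t ∂timeMeasure T, 0 ≤ (u t).α ∧ 0 ≤ (u t).lam) (hK : ‖u‖ ≤ K) :
    ∀ᵐ t ∂timeMeasure T, u t ∈ admissibleControls m n K := by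
  have hle : ∀ᵐ t ∂timeMeasure T, ‖u t‖ₑ ≤ eLpNorm u ∞ (timeMeasure T) := by
    rw [eLpNorm_exponent_top]
    exact ae_le_eLpNormEssSup
  filter_upwards [hnonneg, hle] with t h1 h2
  refine ⟨h1.1, h1.2, le_trans ?_ hK⟩
  rw [Lp.norm_def, ← toReal_enorm]
  exact ENNReal.toReal_mono (Lp.eLpNorm_ne_top u) h2

/-! ### Compactness of the control set -/

/-- Hölder on the finite measure space `[0, T]`, with factor `κ`. It turns equicontinuity in `L^p`
into the `L¹` form needed for compactness. -/
theorem lintegral_le_of_eLpNorm_lt {T : ℝ} {F : Type*} [NormedAddCommGroup F] {p : ℝ≥0∞}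
    (hp1 : 1 ≤ p) {ε : ℝ} (hε : 0 < ε) : ∃ ε' : ℝ, 0 < ε' ∧ ∀ f : ℝ → F, StronglyMeasurable f →
      eLpNorm f p volume < ENNReal.ofReal ε' → ∫⁻ t in Icc 0 T, ‖f t‖ₑ ≤ ENNReal.ofReal ε := by
  set κ := (timeMeasure T univ) ^ (1 / (1 : ℝ≥0∞).toReal - 1 / p.toReal) with hκ
  have hκt : κ ≠ ∞ := by
    refine ENNReal.rpow_ne_top_of_nonneg ?_ (measure_ne_top _ _)
    rcases eq_or_ne p ∞ with rfl | hp
    · simp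
    · have : 1 ≤ p.toReal := by
        rw [← ENNReal.toReal_one]; exact ENNReal.toReal_mono hp hp1
      simp only [ENNReal.toReal_one, div_one, sub_nonneg, one_div]
      exact inv_le_one_of_one_le₀ this
  refine ⟨ε / (κ.toReal + 1), by positivity, fun f hf hlt => ?_⟩
  rw [← eLpNorm_one_eq_lintegral_enorm]
  calc eLpNorm f 1 (timeMeasure T) ≤ eLpNorm f p (timeMeasure T) * κ :=
        eLpNorm_le_eLpNorm_mul_rpow_measure_univ hp1 hf.aestronglyMeasurable
    _ ≤ ENNReal.ofReal (ε / (κ.toReal + 1)) * κ := by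
        gcongr
        exact (eLpNorm_mono_measure _ Measure.restrict_le_self).trans hlt.le
    _ = ENNReal.ofReal (ε / (κ.toReal + 1) * κ.toReal) := by
        rw [ENNReal.ofReal_mul (by positivity), ENNReal.ofReal_toReal hκt]
    _ ≤ ENNReal.ofReal ε := by
        refine ENNReal.ofReal_le_ofReal ?_
        rw [div_mul_eq_mul_div, div_le_iff₀ (by positivity)]
        nlinarith [ENNReal.toReal_nonneg (a := κ)]

/-- Bounded, `L^p`-closed and shift-equicontinuous control sets are sequentially compact with
respect to convergence a.e. -/
theorem exists_subseq_control_tendsto_ae {T : ℝ} (hT : 0 ≤ T) {p : ℝ≥0∞} [hp1 : Fact (1 ≤ p)]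
    (hp : p ≠ ∞) {𝓓 : Set (Lp (ControlSpace m n) ∞ (timeMeasure T))} {K : ℝ}
    (hK : ∀ u ∈ 𝓓, ∀ᵐ t ∂timeMeasure T, ‖u t‖ ≤ K) (hclosed : ClosedInLp T p 𝓓)
    (hequi : ShiftEquicontinuous T p 𝓓) (u : ℕ → Lp (ControlSpace m n) ∞ (timeMeasure T))
    (hu : ∀ k, u k ∈ 𝓓) :
    ∃ φ : ℕ → ℕ, StrictMono φ ∧ ∃ w ∈ 𝓓,
      ∀ᵐ t ∂timeMeasure T, Tendsto (fun k => u (φ k) t) atTop (𝓝 (w t)) := by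
  have hm : ∀ k, StronglyMeasurable ((Icc 0 T).indicator (u k)) := fun k =>
    (Lp.stronglyMeasurable (u k)).indicator measurableSet_Icc
  obtain ⟨φ, hφ, w, hw, hlim⟩ := exists_subseq_tendsto_ae (K := K.toNNReal) hT
    (fun k => (Icc 0 T).indicator (u k)) hm (fun k => by
      filter_upwards [(ae_restrict_iff' measurableSet_Icc).1 (hK _ (hu k))] with t ht
      by_cases hmem : t ∈ Icc 0 T
      · rw [indicator_of_mem hmem]
        exact (ht hmem).trans (Real.le_coe_toNNReal K)
      · rw [indicator_of_notMem hmem, norm_zero]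
        exact NNReal.coe_nonneg _) (fun ε hε => by
      obtain ⟨ε', hε', hle⟩ := lintegral_le_of_eLpNorm_lt (T := T) (F := ControlSpace m n)
        hp1.out hε
      obtain ⟨δ, hδ, hsh⟩ := hequi ε' hε'
      exact ⟨δ, hδ, fun h hh k => hle _
        (((hm k).comp_measurable (measurable_add_const h)).sub (hm k)) (hsh h hh _ (hu k))⟩)
  have hlim' : ∀ᵐ t ∂timeMeasure T, Tendsto (fun k => u (φ k) t) atTop (𝓝 (w t)) := by
    filter_upwards [hlim, ae_restrict_mem measurableSet_Icc] with t ht hmem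
    simpa [indicator_of_mem hmem] using ht
  have hKw : ∀ᵐ t ∂timeMeasure T, ‖w t‖ ≤ K := by
    filter_upwards [hlim', ae_all_iff.2 fun k => hK _ (hu k)] with t h1 h2
    exact le_of_tendsto h1.norm (Eventually.of_forall fun k => h2 (φ k))
  have hmem : ∀ k, MemLp (u (φ k)) p (timeMeasure T) := fun k =>
    MemLp.of_bound (Lp.aestronglyMeasurable _) K (hK _ (hu _))
  have hmemw : MemLp w p (timeMeasure T) := MemLp.of_bound hw.aestronglyMeasurable K hKw
  have htend : Tendsto (fun k => (hmem k).toLp (u (φ k))) atTop (𝓝 (hmemw.toLp w)) := by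
    rw [Lp.tendsto_Lp_iff_tendsto_eLpNorm'']
    exact tendsto_eLpNorm_of_ae_bound hp1.out hp (fun k => Lp.stronglyMeasurable _) hw
      (fun k => hK _ (hu _)) hKw hlim'
  -- Closedness yields a member `v` of `𝓓` that agrees a.e. with the limit `w`, so a.e. convergence
  -- carries over to `v`.
  obtain ⟨v, hv, hwv⟩ := hclosed.mem_of_tendsto htend
    (Eventually.of_forall fun k => ⟨u (φ k), hu _, (hmem k).coeFn_toLp⟩)
  refine ⟨φ, hφ, v, hv, ?_⟩
  filter_upwards [hlim', hwv, hmemw.coeFn_toLp] with t h1 h2 h3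
  rwa [← h2, h3]

/-! ### Continuity of the objective -/

theorem tendsto_integral_rpow_of_ae_bound {T K q : ℝ} (hq : 0 < q) {N : ControlSpace m n → ℝ}
    (hN : Continuous N) (hN0 : ∀ s, 0 ≤ N s) (hNle : ∀ s, N s ≤ ‖s‖)
    {u : ℕ → ℝ → ControlSpace m n} {w : ℝ → ControlSpace m n}
    (hm : ∀ k, StronglyMeasurable (u k)) (hK : ∀ k, ∀ᵐ t ∂timeMeasure T, ‖u k t‖ ≤ K)
    (hlim : ∀ᵐ t ∂timeMeasure T, Tendsto (fun k => u k t) atTop (𝓝 (w t))) :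
    Tendsto (fun k => ∫ t in Icc 0 T, N (u k t) ^ q) atTop (𝓝 (∫ t in Icc 0 T, N (w t) ^ q)) := by
  have hc : Continuous fun s => N s ^ q := hN.rpow_const fun _ => Or.inr hq.le
  refine tendsto_integral_of_dominated_convergence (fun _ => K ^ q)
    (fun k => (hc.comp_stronglyMeasurable (hm k)).aestronglyMeasurable) (integrable_const _)
    (fun k => ?_) ?_
  · filter_upwards [hK k] with t ht
    rw [Real.norm_of_nonneg (Real.rpow_nonneg (hN0 _) _)]
    exact Real.rpow_le_rpow (hN0 _) ((hNle _).trans ht) hq.le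
  · filter_upwards [hlim] with t ht
    exact (hc.tendsto _).comp ht

theorem tendsto_objective {T K q : ℝ} (hq : 0 < q) {ℒ : Euc n → Euc n → ℝ}
    (hℒ : Continuous (Function.uncurry ℒ)) {ψ : ℝ → ℝ} (hψ : Continuous ψ) (β₁ β₂ β₃ : ℝ)
    (y : Euc n) {u : ℕ → ℝ → ControlSpace m n} {w : ℝ → ControlSpace m n} {x : ℕ → ℝ → Euc n}
    {x' : ℝ → Euc n} (hm : ∀ k, StronglyMeasurable (u k))
    (hK : ∀ k, ∀ᵐ t ∂timeMeasure T, ‖u k t‖ ≤ K)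
    (hlim : ∀ᵐ t ∂timeMeasure T, Tendsto (fun k => u k t) atTop (𝓝 (w t)))
    (hx : Tendsto (fun k => x k T) atTop (𝓝 (x' T))) :
    Tendsto (fun k => objective T q ℒ ψ β₁ β₂ β₃ y (u k) (x k)) atTop
      (𝓝 (objective T q ℒ ψ β₁ β₂ β₃ y w x')) := by
  have h1 := tendsto_integral_rpow_of_ae_bound hq ControlSpace.continuous_A.norm
    (fun s => norm_nonneg _) ControlSpace.norm_A_le hm hK hlim
  have h2 := tendsto_integral_rpow_of_ae_bound hq ControlSpace.continuous_α.abs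
    (fun s => abs_nonneg _) ControlSpace.abs_α_le hm hK hlim
  have h3 := tendsto_integral_rpow_of_ae_bound hq ControlSpace.continuous_lam.abs
    (fun s => abs_nonneg _) ControlSpace.abs_lam_le hm hK hlim
  have hpen : ∀ {a : ℕ → ℝ} {a' : ℝ} (β : ℝ), Tendsto a atTop (𝓝 a') →
      Tendsto (fun k => β * ψ (T⁻¹ * a k)) atTop (𝓝 (β * ψ (T⁻¹ * a'))) := fun β ha =>
    ((hψ.tendsto _).comp (ha.const_mul T⁻¹)).const_mul β
  have h0 : Tendsto (fun k => ℒ (x k T) y) atTop (𝓝 (ℒ (x' T) y)) :=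
    (hℒ.tendsto (x' T, y)).comp (hx.prodMk_nhds tendsto_const_nhds)
  exact ((h0.add (hpen β₁ h1)).add (hpen β₂ h2)).add (hpen β₃ h3)

theorem objective_nonneg {T q : ℝ} {ℒ : Euc n → Euc n → ℝ} (hℒ : ∀ x y, 0 ≤ ℒ x y) {ψ : ℝ → ℝ}
    (hψ : ∀ s, 0 ≤ ψ s) {β₁ β₂ β₃ : ℝ} (hβ₁ : 0 ≤ β₁) (hβ₂ : 0 ≤ β₂) (hβ₃ : 0 ≤ β₃) (y : Euc n)
    (u : ℝ → ControlSpace m n) (x : ℝ → Euc n) :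
    0 ≤ objective T q ℒ ψ β₁ β₂ β₃ y u x :=
  add_nonneg (add_nonneg (add_nonneg (hℒ _ _) (mul_nonneg hβ₁ (hψ _))) (mul_nonneg hβ₂ (hψ _)))
    (mul_nonneg hβ₃ (hψ _))

end

end DeepLayer

/-! ### The direct method -/

open DeepLayer Filter Topology in
theorem mainTheorem4 {m n : ℕ} (T : ℝ) (hT : 0 < T)
    (p : ℝ≥0∞) [Fact (1 ≤ p)] (hp : p ≠ ∞)
    (R : DeepLayer.Euc n → ℝ)
    (hA1 : ConvexOn ℝ Set.univ R)
    (hA2 : (0 : DeepLayer.Euc n) ∈ DeepLayer.subdifferential R 0)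
    (hA3 : ∃ M : ℝ, 0 < M ∧ ∀ x : DeepLayer.Euc n,
      (∀ z ∈ DeepLayer.subdifferential R x, ‖z‖ ≤ M * ‖x‖) ∨
      (∀ z ∈ DeepLayer.subdifferential R x, ‖z‖ ≤ M))
    (ℒ : DeepLayer.Euc n → DeepLayer.Euc n → ℝ)
    (hA4 : Continuous (Function.uncurry ℒ) ∧ ∀ x y, 0 ≤ ℒ x y)
    (ψ : ℝ → ℝ) (hA5 : LocallyLipschitz ψ ∧ ∀ s, 0 ≤ ψ s)
    (β₁ β₂ β₃ : ℝ) (hβ₁ : 0 ≤ β₁) (hβ₂ : 0 ≤ β₂) (hβ₃ : 0 ≤ β₃)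
    (b : DeepLayer.Euc m) (x₀ y : DeepLayer.Euc n)
    (𝓓 : Set (Lp (DeepLayer.ControlSpace m n) ∞ (DeepLayer.timeMeasure T)))
    (hne : 𝓓.Nonempty)
    (hnonneg : ∀ u ∈ 𝓓, ∀ᵐ t ∂DeepLayer.timeMeasure T, 0 ≤ (u t).α ∧ 0 ≤ (u t).lam)
    (hbdd : Bornology.IsBounded 𝓓)
    (hclosed : DeepLayer.ClosedInLp T p 𝓓)
    (hequi : DeepLayer.ShiftEquicontinuous T p 𝓓) :
    -- every admissible control has a unique state, so the objective is well defined on `𝓓`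
    (∀ u ∈ 𝓓, (∃ x, DeepLayer.IsState T R b x₀ u x) ∧
      ∀ x x', DeepLayer.IsState T R b x₀ u x → DeepLayer.IsState T R b x₀ u x' →
        Set.EqOn x x' (Set.Icc 0 T)) ∧
    -- and the objective attains its minimum over `𝓓`
    ∃ uStar ∈ 𝓓, ∃ xStar, DeepLayer.IsState T R b x₀ uStar xStar ∧
      ∀ u ∈ 𝓓, ∀ x, DeepLayer.IsState T R b x₀ u x →
        DeepLayer.objective T p.toReal ℒ ψ β₁ β₂ β₃ y uStar xStar ≤
          DeepLayer.objective T p.toReal ℒ ψ β₁ β₂ β₃ y u x := by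

  obtain ⟨M, hM, hA3⟩ := hA3
  have hsub := norm_subgradient_le hM hA3
  obtain ⟨K, hK0, hKn⟩ : ∃ K : ℝ, 0 ≤ K ∧ ∀ u ∈ 𝓓, ‖u‖ ≤ K := by
    obtain ⟨K, hK⟩ := hbdd.exists_norm_le
    exact ⟨max K 0, le_max_right _ _, fun u hu => (hK u hu).trans (le_max_left _ _)⟩
  have hF := fieldBound_control (n := n) b hK0
  have hadm : ∀ u ∈ 𝓓, ∀ᵐ t ∂timeMeasure T, u t ∈ admissibleControls m n K := fun u hu =>
    ae_mem_admissibleControls (hnonneg u hu) (hKn u hu)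
  have hbound : ∀ u ∈ 𝓓, ∀ᵐ t ∂timeMeasure T, ‖u t‖ ≤ K := fun u hu =>
    (hadm u hu).mono fun t ht => ht.2.2
  have hne' : (admissibleControls m n K).Nonempty := by
    obtain ⟨u, hu⟩ := hne
    -- Since `T > 0` the measure is nonzero, so some time carries an admissible control value.
    have : NeBot (ae (timeMeasure T)) := by
      rw [ae_neBot]
      simp [Measure.restrict_eq_zero, hT]
    obtain ⟨t, ht⟩ := (hadm u hu).exists
    exact ⟨_, ht⟩
  have hex : ∀ u ∈ 𝓓, ∃ x, IsState T R b x₀ u x := fun u hu =>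
    let ⟨x, hx⟩ := exists_isSol hF hne' hT.le hA1 hM.le hsub (Lp.stronglyMeasurable u) (hadm u hu)
    ⟨x, isState_iff_isSol.2 hx⟩
  have huniq : ∀ u ∈ 𝓓, ∀ x x', IsState T R b x₀ u x → IsState T R b x₀ u x' →
      EqOn x x' (Icc 0 T) := fun u hu x x' hx hx' =>
    IsSol.eqOn hF hT.le hM.le hsub (Lp.stronglyMeasurable u) (hadm u hu)
      (isState_iff_isSol.1 hx) (isState_iff_isSol.1 hx')
  refine ⟨fun u hu => ⟨hex u hu, huniq u hu⟩, ?_⟩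
  have hq : 0 < p.toReal :=
    ENNReal.toReal_pos (zero_lt_one.trans_le (Fact.out : 1 ≤ p)).ne' hp
  set J := objective (m := m) T p.toReal ℒ ψ β₁ β₂ β₃ y with hJ
  -- Values are collected over all pairs of a control and one of its states, so the infimum bounds
  -- the objective for whichever state is supplied.
  set V : Set ℝ := {r | ∃ u ∈ 𝓓, ∃ x, IsState T R b x₀ u x ∧ J u x = r} with hV
  have hVne : V.Nonempty := by
    obtain ⟨u, hu⟩ := hne
    obtain ⟨x, hx⟩ := hex u hu
    exact ⟨_, u, hu, x, hx, rfl⟩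
  have hVbdd : BddBelow V := by
    refine ⟨0, ?_⟩
    rintro _ ⟨u, -, x, -, rfl⟩
    exact objective_nonneg hA4.2 hA5.2 hβ₁ hβ₂ hβ₃ y _ _
  obtain ⟨r, -, hr, hrV⟩ := exists_seq_tendsto_sInf hVne hVbdd
  choose u hu x hx hJu using hrV
  obtain ⟨φ, hφ, w, hw, hlim⟩ :=
    exists_subseq_control_tendsto_ae hT.le hp hbound hclosed hequi u hu
  obtain ⟨xw, hxw⟩ := hex w hw
  have hxlim : Tendsto (fun k => x (φ k) T) atTop (𝓝 (xw T)) :=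
    tendsto_of_tendsto_control_ae hF hT.le hM.le hsub (fun k => Lp.stronglyMeasurable (u (φ k)))
      (Lp.stronglyMeasurable w) (fun k => hadm _ (hu _)) (hadm w hw) (fun k => isState_iff_isSol.1 (hx (φ k)))
      (isState_iff_isSol.1 hxw) hlim
      ⟨hT.le, le_rfl⟩
  have hJlim := tendsto_objective (K := K) hq hA4.1 hA5.1.continuous β₁ β₂ β₃ y
    (fun k => Lp.stronglyMeasurable (u (φ k))) (fun k => hbound _ (hu _)) hlim hxlim
  have hJw : J w xw = sInf V := by
    refine tendsto_nhds_unique hJlim ?_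
    have := hr.comp hφ.tendsto_atTop
    refine this.congr fun k => ?_
    exact (hJu (φ k)).symm
  refine ⟨w, hw, xw, hxw, fun v hv z hz => ?_⟩
  rw [hJw]
  exact csInf_le hVbdd ⟨v, hv, z, hz, rfl⟩
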